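/- Let $n\ge 1$, $\gamma\in(0,1)$, $T>0$, $\tau>0$, $s>0$, $p>0$ and $M>0$. Write $\widehat f(\xi)=(2\pi)^{-n/2}\int_{\mathbb R^n}f(x)e^{-ix\cdot\xi}\,dx$ for the Fourier transform on $L^2(\mathbb R^n)$, $\|f\|_{H^r}=\|(1+|\xi|^2)^{r/2}\widehat f\|_{L^2}$ for the norm of the Sobolev space $H^r(\mathbb R^n)$, and $E_{\gamma,1}(z)=\sum_{k\ge0}z^k/\Gamma(\gamma k+1)$ for the Mittag-Leffler function. Let $\varphi$ be the kernel with $\widehat\varphi(\xi)=(2\pi)^{-n/2}\exp(-\tau|\xi|^s)$. There is a constant $C>0$, depending only on $n,\gamma,T,\tau,s,p,M$, such that the following holds for all $E>0$, $\delta\ge 0$ with $\delta\le ME$, and $0\le h\le 1/2$. Let $u\in C([0,T],L^2(\mathbb R^n))\cap C((0,T],H^2(\mathbb R^n))$ be the solution of the final value problem $$\frac{\partial^\gamma u}{\partial t^\gamma}=\Delta u\quad\text{on }\mathbb R^n\times(0,T),\qquad u(\cdot,T)=g,$$ where $\frac{\partial^\gamma u}{\partial t^\gamma}(t)=\frac1{\Gamma(1-\gamma)}\int_0^t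 (t-r)^{-\gamma}u'(r)\,dr$ is the Caputo derivative and the equation holds in $L^2(\mathbb R^n)$ for every $t\in(0,T)$. Assume that $u(\cdot,0)\in H^p(\mathbb R^n)$ with $\|u(\cdot,0)\|_{H^p}\le E$. Let $g^\delta\in L^2(\mathbb R^n)$ satisfy $\|g-g^\delta\|_{L^2}\le\delta$, and let $\psi_h$ be a positive function on $[0,\infty)\times(0,T]$ with $$\left\|\frac{\psi_h(|\xi|,t)-E_{\gamma,1}(-|\xi|^2t^\gamma)}{E_{\gamma,1}(-|\xi|^2t^\gamma)}\right\|_{L^\infty(\mathbb R^n)}\le h\qquad\text{for all }t\in(0,T].$$ Put $\alpha=(h+\delta/E)^{1/(p+2)}$. Then there is exactly one $u^{\delta,h}_\alpha(\cdot,0)\in L^2(\mathbb R^n)$ with $$\widehat{u^{\delta,h}_\alpha}(\xi,0)=(2\pi)^{n/2}\,\widehat\varphi(\alpha\xi)\,\frac{\widehat{g^\delta}(\xi)}{\psi_h(|\xi|,T)},$$ and for every $l\in[0,p]$ with $p-l\le s$, $$\|u(\cdot,0)-u^{\delta,h}_\alpha(\cdot,0)\|_{H^l}\le C\,E^{\frac{2+l}{p+2}}\,(\delta+hE)^{\frac{p-l}{p+2}}.$$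 -/

import Mathlib

open MeasureTheory Set Filter Topology
open scoped ENNReal FourierTransform SchwartzMap Laplacian

noncomputable section

namespace FracDiffusion

/-- The space `ℝⁿ` with its Euclidean norm. -/
abbrev Rn (n : ℕ) : Type := EuclideanSpace ℝ (Fin n)

/-- The complex Hilbert space `L²(ℝⁿ)`. -/
abbrev L2 (n : ℕ) : Type := Lp ℂ 2 (volume : Measure (Rn n))

/-- The Mittag-Leffler function `E_{γ,1}` on the real line. -/
def mittagLeffler (γ : ℝ) (x : ℝ) : ℝ :=
  ∑' k : ℕ, x ^ k / Real.Gamma (γ * k + 1)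

/-- The unitary Fourier transform
`f̂(ξ) = (2π)^{-n/2} ∫ f(x) e^{-i x·ξ} dx` of `f ∈ L²(ℝⁿ)`, as a function defined almost everywhere.
Mathlib's transform `𝓕` has the kernel `e^{-2πi x·η}`, whence the rescaling `η = ξ / (2π)`. -/
def fourierHat {n : ℕ} (f : L2 n) (ξ : Rn n) : ℂ :=
  (((√(2 * Real.pi)) ^ n)⁻¹ : ℝ) • (𝓕 f : L2 n) ((2 * Real.pi)⁻¹ • ξ)

/-- The norm of `H^r(ℝⁿ)`, that is `‖(1 + |ξ|²)^{r/2} f̂‖_{L²}`, with the value `∞` for those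
`f ∈ L²(ℝⁿ)` that do not belong to `H^r(ℝⁿ)`. -/
def sobolevNorm {n : ℕ} (r : ℝ) (f : L2 n) : ℝ≥0∞ :=
  eLpNorm (fun ξ : Rn n => (((1 + ‖ξ‖ ^ 2) ^ (r / 2) : ℝ) : ℂ) * fourierHat f ξ) 2 volume

/-- The Caputo derivative of order `γ` of a curve in `L²(ℝⁿ)`, as a Bochner integral. -/
def caputoDeriv {n : ℕ} (γ : ℝ) (u : ℝ → L2 n) (t : ℝ) : L2 n :=
  (1 / Real.Gamma (1 - γ)) • ∫ s in (0 : ℝ)..t, ((t - s) ^ (-γ) : ℝ) • deriv u s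

/-- `u` is a (weak) solution of `∂^γ u / ∂t^γ = Δ u` on `ℝⁿ × (0,T)` with `u(·,T) = g`:
it lies in `C([0,T], L²) ∩ C((0,T], H²)`, and the equation holds in `L²(ℝⁿ)` at each `t ∈ (0,T)`,
where the Laplacian is the distributional one. -/
structure IsSolution {n : ℕ} (γ T : ℝ) (g : L2 n) (u : ℝ → L2 n) : Prop where
  continuousOn : ContinuousOn u (Icc 0 T)
  mem_H2 : ∀ t ∈ Ioc 0 T, sobolevNorm 2 (u t) < ∞
  continuousOn_H2 : ∀ t ∈ Ioc 0 T,
    Tendsto (fun t' => sobolevNorm 2 (u t' - u t)) (𝓝[Ioc 0 T] t) (𝓝 0)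
  differentiableAt : ∀ t ∈ Ioo 0 T, DifferentiableAt ℝ u t
  integrable : ∀ t ∈ Ioo 0 T,
    IntervalIntegrable (fun s => ((t - s) ^ (-γ) : ℝ) • deriv u s) volume 0 t
  equation : ∀ t ∈ Ioo 0 T,
    ((caputoDeriv γ u t : L2 n) : 𝓢'(Rn n, ℂ)) = Δ ((u t : L2 n) : 𝓢'(Rn n, ℂ))
  final : u T = g

/-- The Fourier transform `φ̂(ξ) = (2π)^{-n/2} exp(-τ |ξ|^s)` of the mollifier kernel `φ`. -/
def kernelHat {n : ℕ} (τ s : ℝ) (ξ : Rn n) : ℝ :=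
  ((√(2 * Real.pi)) ^ n)⁻¹ * Real.exp (-τ * ‖ξ‖ ^ s)

/-- `ψ` is a positive function on `[0,∞) × (0,T]` that approximates
`(r,t) ↦ E_{γ,1}(-r² t^γ)` with relative error at most `h` in `L^∞(ℝⁿ)`, for each `t`. -/
structure IsApproxSymbol (n : ℕ) (γ T h : ℝ) (ψ : ℝ → ℝ → ℝ) : Prop where
  pos : ∀ r, 0 ≤ r → ∀ t ∈ Ioc 0 T, 0 < ψ r t
  aestronglyMeasurable : ∀ t ∈ Ioc 0 T,
    AEStronglyMeasurable (fun ξ : Rn n => ψ ‖ξ‖ t) volume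
  error_le : ∀ t ∈ Ioc 0 T,
    eLpNorm (fun ξ : Rn n =>
      (ψ ‖ξ‖ t - mittagLeffler γ (-‖ξ‖ ^ 2 * t ^ γ)) / mittagLeffler γ (-‖ξ‖ ^ 2 * t ^ γ))
      ∞ volume ≤ ENNReal.ofReal h

/-- `v` is the initial value `u_α^{δ,h}(·,0)` of the regularized solution, the element of
`L²(ℝⁿ)` with Fourier transform `(2π)^{n/2} φ̂(αξ) ĝ^δ(ξ) / ψ_h(|ξ|,T)`. -/
def IsRegularizedInitial {n : ℕ} (τ s T α : ℝ) (ψ : ℝ → ℝ → ℝ) (gδ v : L2 n) : Prop :=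
  ∀ᵐ ξ : Rn n ∂volume, fourierHat v ξ =
    (((√(2 * Real.pi)) ^ n * kernelHat τ s (α • ξ) : ℝ) : ℂ) *
      (fourierHat gδ ξ / ((ψ ‖ξ‖ T : ℝ) : ℂ))

end FracDiffusion

end

/-!
On the Fourier side the fractional heat equation acts on each frequency separately, and
`ĝ(ξ) = E_{γ,1}(-|ξ|² T^γ) û(ξ, 0)`. To see this for an `L²`-valued solution, truncate the
frequencies to a ball: the Laplacian becomes a bounded multiplication operator, and the equation,
integrated to order `γ`, becomes a Volterra equation whose Picard iterates are the partial sums of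
the Mittag-Leffler series.

Since `y(t) = E_{γ,1}(-t^γ)` solves `∂^γ y = -y`, an extremum principle for the Caputo derivative at
the running minima of `y` gives `E_{γ,1}(-x) ≥ (1 + Γ(1 - γ) x)⁻¹`. Dividing by the symbol, or by
its approximation `ψ_h`, therefore amplifies the noise by at most a multiple of `1 + |ξ|²`, which
the mollifier cuts off at `|ξ| ~ 1/α`. In `H^l` the mollification costs `α^{p-l} E` and the noise
`α^{-(l+2)} δ`, while the error in the symbol contributes a multiple of `h E`; the choice
`α^{p+2} = h + δ/E` makes all of these `O(α^{p-l} E)`.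
-/

namespace FracDiffusion

/-! ### Fractional integrals -/

section FractionalIntegral

variable {a b r t : ℝ} {E : Type*} [NormedAddCommGroup E] [NormedSpace ℝ E] {f : ℝ → E}

theorem integral_sub_rpow_mul_rpow (ha : 0 < a) (hb : 0 < b) (ht : 0 < t) :
    ∫ s in (0 : ℝ)..t, (t - s) ^ (a - 1) * s ^ (b - 1) =
      t ^ (a + b - 1) * (Real.Gamma a * Real.Gamma b / Real.Gamma (a + b)) := by
  have hscaled := Complex.betaIntegral_scaled (b : ℂ) (a : ℂ) ht
  have hbeta := ProbabilityTheory.beta_eq_betaIntegralReal b a hb ha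
  have hreal : ∀ s ∈ uIcc 0 t, (s : ℂ) ^ ((b : ℂ) - 1) * ((t : ℂ) - s) ^ ((a : ℂ) - 1) =
      ((t - s) ^ (a - 1) * s ^ (b - 1) : ℝ) := by
    intro s hs
    rw [uIcc_of_le ht.le] at hs
    push_cast
    rw [Complex.ofReal_cpow hs.1, Complex.ofReal_cpow (sub_nonneg.2 hs.2), mul_comm]
    push_cast
    rfl
  have hpow : (t : ℂ) ^ ((b : ℂ) + a - 1) = (t ^ (a + b - 1) : ℝ) := by
    rw [Complex.ofReal_cpow ht.le]
    push_cast
    rw [add_comm (b : ℂ)]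
  rw [intervalIntegral.integral_congr hreal, intervalIntegral.integral_ofReal, hpow] at hscaled
  have hre := congrArg Complex.re hscaled
  rw [Complex.ofReal_re, Complex.re_ofReal_mul, ← hbeta, ProbabilityTheory.beta] at hre
  rw [hre, mul_comm (Real.Gamma b), add_comm b]

theorem integral_sub_rpow_mul_sub_rpow (ha : 0 < a) (hb : 0 < b) (hrt : r < t) :
    ∫ s in r..t, (t - s) ^ (a - 1) * (s - r) ^ (b - 1) =
      (t - r) ^ (a + b - 1) * (Real.Gamma a * Real.Gamma b / Real.Gamma (a + b)) := by
  have hshift := intervalIntegral.integral_comp_sub_right (a := r) (b := t)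
    (fun x => (t - r - x) ^ (a - 1) * x ^ (b - 1)) r
  simp only [sub_self, sub_sub_sub_cancel_right] at hshift
  rw [hshift, integral_sub_rpow_mul_rpow ha hb (sub_pos.2 hrt)]

theorem intervalIntegrable_sub_rpow_mul_sub_rpow (ha : 0 < a) (hb : 0 < b) (hrt : r < t) :
    IntervalIntegrable (fun s => (t - s) ^ (a - 1) * (s - r) ^ (b - 1)) volume r t := by
  apply intervalIntegral.intervalIntegrable_of_integral_ne_zero
  rw [integral_sub_rpow_mul_sub_rpow ha hb hrt]
  have := sub_pos.2 hrt
  have := Real.Gamma_pos_of_pos ha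
  have := Real.Gamma_pos_of_pos hb
  have := Real.Gamma_pos_of_pos (add_pos ha hb)
  positivity

theorem intervalIntegrable_sub_rpow (ha : 0 < a) :
    IntervalIntegrable (fun s => (t - s) ^ (a - 1)) volume r t := by
  simpa using (intervalIntegral.intervalIntegrable_rpow' (a := t - r) (b := 0)
    (show -1 < a - 1 by linarith)).comp_sub_left t

theorem intervalIntegrable_sub_rpow_smul (ha : 0 < a) (hrt : r ≤ t)
    (hf : ContinuousOn f (Icc r t)) :
    IntervalIntegrable (fun s => (t - s) ^ (a - 1) • f s) volume r t :=
  (intervalIntegrable_sub_rpow ha).smul_continuousOn (by rwa [uIcc_of_le hrt])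

theorem aestronglyMeasurable_of_sub_rpow_smul
    (hf : IntervalIntegrable (fun s => (t - s) ^ a • f s) volume r t) :
    AEStronglyMeasurable f (volume.restrict (Ioc r t)) := by
  have hmeas : Measurable fun s : ℝ => (t - s) ^ (-a) := by fun_prop
  refine (hmeas.aestronglyMeasurable.smul hf.1.aestronglyMeasurable).congr ?_
  filter_upwards [ae_restrict_mem measurableSet_Ioc,
    ae_restrict_of_ae (Measure.ae_ne volume t)] with s hs hst
  have hpos : 0 < t - s := sub_pos.2 (lt_of_le_of_ne hs.2 hst)
  rw [Pi.smul_apply', smul_smul, ← Real.rpow_add hpos, neg_add_cancel, Real.rpow_zero, one_smul]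

/-- The Riemann–Liouville integral of order `a` based at `0`. At `t < 0` it has the junk value
given by Mathlib's conventions for reversed intervals and powers of negative numbers. -/
noncomputable def fracIntegral (a : ℝ) (f : ℝ → E) (t : ℝ) : E :=
  (Real.Gamma a)⁻¹ • ∫ s in (0 : ℝ)..t, (t - s) ^ (a - 1) • f s

theorem fracIntegral_congr {f g : ℝ → E} (ht : 0 ≤ t) (h : ∀ s ∈ Ioo 0 t, f s = g s) :
    fracIntegral a f t = fracIntegral a g t := by
  simp only [fracIntegral, intervalIntegral.integral_of_le ht, integral_Ioc_eq_integral_Ioo]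
  rw [setIntegral_congr_fun measurableSet_Ioo fun s hs => by rw [h s hs]]

theorem fracIntegral_sub {f g : ℝ → E} (ha : 0 < a) (ht : 0 ≤ t) (hf : ContinuousOn f (Icc 0 t))
    (hg : ContinuousOn g (Icc 0 t)) :
    fracIntegral a (fun s => f s - g s) t = fracIntegral a f t - fracIntegral a g t := by
  simp only [fracIntegral, smul_sub]
  rw [intervalIntegral.integral_sub (intervalIntegrable_sub_rpow_smul ha ht hf)
    (intervalIntegrable_sub_rpow_smul ha ht hg), smul_sub]

theorem fracIntegral_sum {ι : Type*} {f : ι → ℝ → E} (K : Finset ι) (ha : 0 < a) (ht : 0 ≤ t)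
    (hf : ∀ k, ContinuousOn (f k) (Icc 0 t)) :
    fracIntegral a (fun s => ∑ k ∈ K, f k s) t = ∑ k ∈ K, fracIntegral a (f k) t := by
  simp only [fracIntegral, Finset.smul_sum]
  rw [intervalIntegral.integral_finsetSum fun k _ =>
    intervalIntegrable_sub_rpow_smul ha ht (hf k), Finset.smul_sum]

theorem fracIntegral_smul_const [CompleteSpace E] (g : ℝ → ℝ) (v : E) :
    fracIntegral a (fun s => g s • v) t = fracIntegral a g t • v := by
  simp only [fracIntegral, ← smul_assoc, intervalIntegral.integral_smul_const]

theorem fracIntegral_rpow (ha : 0 < a) (hb : -1 < b) (ht : 0 < t) :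
    fracIntegral a (fun s => s ^ b / Real.Gamma (b + 1)) t =
      t ^ (a + b) / Real.Gamma (a + b + 1) := by
  have hb' : 0 < b + 1 := by linarith
  have hGa := (Real.Gamma_pos_of_pos ha).ne'
  have hGb := (Real.Gamma_pos_of_pos hb').ne'
  have hbeta := integral_sub_rpow_mul_rpow ha hb' ht
  rw [add_sub_cancel_right, ← add_assoc, add_sub_cancel_right] at hbeta
  simp only [fracIntegral, smul_eq_mul, mul_div_assoc', intervalIntegral.integral_div]
  rw [hbeta]
  field_simp

theorem norm_fracIntegral_le {K : ℝ} (ha : 0 < a) (hb : -1 < b) (ht : 0 < t)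
    (hf : ∀ s ∈ Ioc 0 t, ‖f s‖ ≤ K * (s ^ b / Real.Gamma (b + 1))) :
    ‖fracIntegral a f t‖ ≤ K * (t ^ (a + b) / Real.Gamma (a + b + 1)) := by
  have hΓ := Real.Gamma_pos_of_pos ha
  have hInt : IntervalIntegrable
      (fun s => K / Real.Gamma (b + 1) * ((t - s) ^ (a - 1) * s ^ b)) volume 0 t := by
    simpa using (intervalIntegrable_sub_rpow_mul_sub_rpow (b := b + 1) ha
      (by linarith) ht).const_mul (K / Real.Gamma (b + 1))
  rw [fracIntegral, norm_smul, norm_inv, Real.norm_of_nonneg hΓ.le]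
  calc (Real.Gamma a)⁻¹ * ‖∫ s in (0 : ℝ)..t, (t - s) ^ (a - 1) • f s‖
      ≤ (Real.Gamma a)⁻¹ *
          ∫ s in (0 : ℝ)..t, K / Real.Gamma (b + 1) * ((t - s) ^ (a - 1) * s ^ b) := by
        gcongr
        refine intervalIntegral.norm_integral_le_of_norm_le ht.le
          (Eventually.of_forall fun s hs => ?_) hInt
        have hk := Real.rpow_nonneg (sub_nonneg.2 hs.2) (a - 1)
        rw [norm_smul, Real.norm_of_nonneg hk]
        exact (mul_le_mul_of_nonneg_left (hf s hs) hk).trans_eq (by ring)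
    _ = K * fracIntegral a (fun s => s ^ b / Real.Gamma (b + 1)) t := by
        simp only [fracIntegral, smul_eq_mul, mul_div_assoc', intervalIntegral.integral_div,
          intervalIntegral.integral_const_mul]
        ring
    _ = K * (t ^ (a + b) / Real.Gamma (a + b + 1)) := by rw [fracIntegral_rpow ha hb ht]

theorem hasSum_fracIntegral_rpow {c b : ℕ → ℝ} (ha : 0 < a) (hb : ∀ k, -1 < b k) (ht : 0 < t)
    (hc : Summable fun k => |c k| * (t ^ (a + b k) / Real.Gamma (a + b k + 1))) :
    HasSum (fun k => c k * (t ^ (a + b k) / Real.Gamma (a + b k + 1)))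
      (fracIntegral a (fun s => ∑' k, c k * (s ^ b k / Real.Gamma (b k + 1))) t) := by
  set e : ℕ → ℝ → ℝ := fun k s => (t - s) ^ (a - 1) * (s ^ b k / Real.Gamma (b k + 1)) with he
  have he_nonneg : ∀ k, ∀ s ∈ Ioc 0 t, 0 ≤ e k s := fun k s hs =>
    mul_nonneg (Real.rpow_nonneg (sub_nonneg.2 hs.2) _) (div_nonneg (Real.rpow_nonneg hs.1.le _)
      (Real.Gamma_pos_of_pos (by linarith [hb k])).le)
  have he_int : ∀ k, IntegrableOn (e k) (Ioc 0 t) := fun k => by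
    have h := (intervalIntegrable_sub_rpow_mul_sub_rpow (b := b k + 1) ha
      (by linarith [hb k]) ht).div_const (Real.Gamma (b k + 1))
    simpa only [he, mul_div_assoc, sub_zero, add_sub_cancel_right] using h.1
  have he_eq : ∀ k, (Real.Gamma a)⁻¹ * ∫ s in Ioc 0 t, e k s =
      t ^ (a + b k) / Real.Gamma (a + b k + 1) := fun k => by
    rw [← fracIntegral_rpow ha (hb k) ht, fracIntegral, intervalIntegral.integral_of_le ht.le]
    rfl
  have hnorm : ∀ k, ∫ s in Ioc 0 t, ‖c k * e k s‖ =
      Real.Gamma a * (|c k| * (t ^ (a + b k) / Real.Gamma (a + b k + 1))) := fun k => by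
    rw [← he_eq, ← integral_const_mul, ← integral_const_mul, ← integral_const_mul]
    refine setIntegral_congr_fun measurableSet_Ioc fun s hs => ?_
    have := (Real.Gamma_pos_of_pos ha).ne'
    simp only [norm_mul, Real.norm_eq_abs, abs_of_nonneg (he_nonneg k s hs)]
    field_simp
  have hsum := (hasSum_integral_of_summable_integral_norm (fun k => (he_int k).const_mul (c k))
    (by simpa only [hnorm] using hc.mul_left (Real.Gamma a))).mul_left (Real.Gamma a)⁻¹
  simp only [integral_const_mul, mul_left_comm (Real.Gamma a)⁻¹, he_eq] at hsum
  rw [fracIntegral, intervalIntegral.integral_of_le ht.le]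
  simpa only [he, smul_eq_mul, ← tsum_mul_left, mul_left_comm ((t - _) ^ (a - 1))] using hsum

theorem Ioc_inter_Ici_of_mem {y : ℝ} (hy : y ∈ Ioc r t) : Ioc r t ∩ Ici y = Icc y t := by
  ext x
  exact ⟨fun h => ⟨h.2, h.1.2⟩, fun h => ⟨⟨hy.1.trans_le h.1, h.2⟩, h.1⟩⟩

theorem integral_triangle_swap {F : ℝ × ℝ → E} (hrt : r ≤ t)
    (hF : Integrable ({z : ℝ × ℝ | z.2 ≤ z.1}.indicator F)
      ((volume.restrict (Ioc r t)).prod (volume.restrict (Ioc r t)))) :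
    ∫ x in r..t, ∫ y in r..x, F (x, y) = ∫ y in r..t, ∫ x in y..t, F (x, y) := by
  simp only [intervalIntegral.integral_of_le hrt]
  calc ∫ x in Ioc r t, ∫ y in r..x, F (x, y)
      = ∫ x in Ioc r t, ∫ y in Ioc r t, {z : ℝ × ℝ | z.2 ≤ z.1}.indicator F (x, y) := by
        refine setIntegral_congr_fun measurableSet_Ioc fun x hx => ?_
        have hset : Ioc r t ∩ Iic x = Ioc r x := by rw [Ioc_inter_Iic, min_eq_right hx.2]
        simp only [intervalIntegral.integral_of_le hx.1.le]
        rw [← hset, ← setIntegral_indicator measurableSet_Iic]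
        rfl
    _ = ∫ y in Ioc r t, ∫ x in Ioc r t, {z : ℝ × ℝ | z.2 ≤ z.1}.indicator F (x, y) :=
        integral_integral_swap hF
    _ = ∫ y in Ioc r t, ∫ x in y..t, F (x, y) := by
        refine setIntegral_congr_fun measurableSet_Ioc fun y hy => ?_
        simp only [intervalIntegral.integral_of_le hy.2]
        rw [← integral_Icc_eq_integral_Ioc (x := y), ← Ioc_inter_Ici_of_mem hy,
          ← setIntegral_indicator measurableSet_Ici]
        rfl

theorem integrable_sub_rpow_mul_sub_rpow_smul (ha : 0 < a) (hb : 0 < b)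
    (hf : IntervalIntegrable (fun s => (t - s) ^ (a + b - 1) • f s) volume 0 t) :
    Integrable ({z : ℝ × ℝ | z.2 ≤ z.1}.indicator
        fun z => ((t - z.1) ^ (a - 1) * (z.1 - z.2) ^ (b - 1)) • f z.2)
      ((volume.restrict (Ioc 0 t)).prod (volume.restrict (Ioc 0 t))) := by
  have hmeas : Measurable fun z : ℝ × ℝ => (t - z.1) ^ (a - 1) * (z.1 - z.2) ^ (b - 1) := by
    fun_prop
  refine (integrable_prod_iff' ((hmeas.aestronglyMeasurable.fun_smul
    (aestronglyMeasurable_of_sub_rpow_smul hf).comp_snd).indicator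
      (measurableSet_le measurable_snd measurable_fst))).2 ⟨?_, ?_⟩
  · filter_upwards [ae_restrict_mem measurableSet_Ioc,
      ae_restrict_of_ae (Measure.ae_ne volume t)] with y hy hyt
    change Integrable ((Ici y).indicator
      fun x => ((t - x) ^ (a - 1) * (x - y) ^ (b - 1)) • f y) _
    rw [integrable_indicator_iff measurableSet_Ici, IntegrableOn,
      Measure.restrict_restrict measurableSet_Ici, inter_comm, Ioc_inter_Ici_of_mem hy,
      ← IntegrableOn, integrableOn_Icc_iff_integrableOn_Ioc]
    exact (intervalIntegrable_sub_rpow_mul_sub_rpow ha hb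
      (lt_of_le_of_ne hy.2 hyt)).1.smul_const (f y)
  · refine (hf.norm.const_mul (Real.Gamma a * Real.Gamma b / Real.Gamma (a + b))).1.congr ?_
    filter_upwards [ae_restrict_mem measurableSet_Ioc,
      ae_restrict_of_ae (Measure.ae_ne volume t)] with y hy hyt
    have hnorm : ∀ x ∈ Ioc 0 t, ‖{z : ℝ × ℝ | z.2 ≤ z.1}.indicator
        (fun z => ((t - z.1) ^ (a - 1) * (z.1 - z.2) ^ (b - 1)) • f z.2) (x, y)‖ =
        (Ici y).indicator (fun x => (t - x) ^ (a - 1) * (x - y) ^ (b - 1) * ‖f y‖) x := by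
      intro x hx
      by_cases hyx : y ≤ x
      · rw [indicator_of_mem (by exact hyx), indicator_of_mem (by exact hyx), norm_smul,
          Real.norm_of_nonneg (mul_nonneg (Real.rpow_nonneg (sub_nonneg.2 hx.2) _)
            (Real.rpow_nonneg (sub_nonneg.2 hyx) _))]
      · rw [indicator_of_notMem (by exact hyx), indicator_of_notMem (by exact hyx), norm_zero]
    rw [setIntegral_congr_fun measurableSet_Ioc hnorm, setIntegral_indicator measurableSet_Ici,
      Ioc_inter_Ici_of_mem hy, integral_Icc_eq_integral_Ioc, integral_mul_const,
      ← intervalIntegral.integral_of_le hy.2,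
      integral_sub_rpow_mul_sub_rpow ha hb (lt_of_le_of_ne hy.2 hyt), norm_smul,
      Real.norm_of_nonneg (Real.rpow_nonneg (sub_nonneg.2 hy.2) _)]
    ring

theorem fracIntegral_fracIntegral [CompleteSpace E] (ha : 0 < a) (hb : 0 < b) (ht : 0 ≤ t)
    (hf : IntervalIntegrable (fun s => (t - s) ^ (a + b - 1) • f s) volume 0 t) :
    fracIntegral a (fracIntegral b f) t = fracIntegral (a + b) f t := by
  have hGa := (Real.Gamma_pos_of_pos ha).ne'
  have hGb := (Real.Gamma_pos_of_pos hb).ne'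
  have hswap := integral_triangle_swap ht (integrable_sub_rpow_mul_sub_rpow_smul ha hb hf)
  have hinner : ∀ r ∈ Ioo 0 t,
      ∫ s in r..t, ((t - s) ^ (a - 1) * (s - r) ^ (b - 1)) • f r =
        (Real.Gamma a * Real.Gamma b / Real.Gamma (a + b)) • (t - r) ^ (a + b - 1) • f r :=
    fun r hr => by
      rw [intervalIntegral.integral_smul_const, integral_sub_rpow_mul_sub_rpow ha hb hr.2,
        mul_comm, mul_smul]
  rw [intervalIntegral.integral_of_le ht (f := fun y => ∫ x in y..t, _),
    integral_Ioc_eq_integral_Ioo, setIntegral_congr_fun measurableSet_Ioo hinner, integral_smul,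
    ← integral_Ioc_eq_integral_Ioo, ← intervalIntegral.integral_of_le ht] at hswap
  simp only [mul_smul, intervalIntegral.integral_smul] at hswap
  simp only [fracIntegral, smul_comm _ (Real.Gamma b)⁻¹, intervalIntegral.integral_smul]
  rw [hswap, smul_smul, smul_smul]
  congr 1
  field_simp

theorem fracIntegral_fracIntegral_deriv [CompleteSpace E] (ha : a ∈ Ioo (0 : ℝ) 1) (ht : 0 ≤ t)
    {y : ℝ → E} (hc : ContinuousOn y (Icc 0 t)) (hd : ∀ s ∈ Ioo 0 t, DifferentiableAt ℝ y s)
    (hi : IntervalIntegrable (fun s => (t - s) ^ (-a) • deriv y s) volume 0 t) :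
    fracIntegral a (fracIntegral (1 - a) (deriv y)) t = y t - y 0 := by
  have hderiv : IntervalIntegrable (fun s => (t - s) ^ (a + (1 - a) - 1) • deriv y s)
      volume 0 t := by
    refine (hi.continuousOn_smul (f := fun s => (t - s) ^ a)
      ((Real.continuous_rpow_const ha.1.le).comp
        (continuous_const.sub continuous_id)).continuousOn).congr_ae ?_
    filter_upwards [ae_restrict_mem measurableSet_uIoc,
      ae_restrict_of_ae (Measure.ae_ne volume t)] with s hs hst
    rw [uIoc_of_le ht] at hs
    have hpos : 0 < t - s := sub_pos.2 (lt_of_le_of_ne hs.2 hst)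
    rw [smul_smul, ← Real.rpow_add hpos]
    ring_nf
  rw [fracIntegral_fracIntegral ha.1 (sub_pos.2 ha.2) ht hderiv]
  simp only [add_sub_cancel, sub_self, Real.rpow_zero, one_smul] at hderiv
  simp only [fracIntegral, add_sub_cancel, sub_self, Real.rpow_zero, one_smul, Real.Gamma_one,
    inv_one]
  exact intervalIntegral.integral_eq_sub_of_hasDerivAt_of_le ht hc
    (fun s hs => (hd s hs).hasDerivAt) hderiv

theorem map_fracIntegral {F : Type*} [NormedAddCommGroup F] [NormedSpace ℝ F] [CompleteSpace E]
    [CompleteSpace F] (L : E →L[ℝ] F)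
    (hf : IntervalIntegrable (fun s => (t - s) ^ (a - 1) • f s) volume 0 t) :
    L (fracIntegral a f t) = fracIntegral a (fun s => L (f s)) t := by
  simp only [fracIntegral, map_smul]
  rw [← L.intervalIntegral_comp_comm hf]
  simp only [map_smul]

theorem map_eq_add_fracIntegral {F : Type*} [NormedAddCommGroup F] [NormedSpace ℝ F]
    [CompleteSpace E] [CompleteSpace F] {T : ℝ} {y : ℝ → E} (L : E →L[ℝ] F) (B : F →L[ℝ] F)
    (ha : a ∈ Ioo (0 : ℝ) 1) (hc : ContinuousOn y (Icc 0 T))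
    (hd : ∀ t ∈ Ioo 0 T, DifferentiableAt ℝ y t)
    (hi : ∀ t ∈ Ioo 0 T, IntervalIntegrable (fun s => (t - s) ^ (-a) • deriv y s) volume 0 t)
    (hL : ∀ t ∈ Ioo 0 T, L (fracIntegral (1 - a) (deriv y) t) = B (L (y t))) :
    ∀ t ∈ Ioo 0 T, L (y t) = L (y 0) + fracIntegral a (fun s => B (L (y s))) t := by
  intro t ht
  have hderiv : ∀ s ∈ Ioo 0 T, HasDerivAt (fun s => L (y s)) (L (deriv y s)) s := fun s hs =>
    L.hasFDerivAt.comp_hasDerivAt s (hd s hs).hasDerivAt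
  have hmem : ∀ s ∈ Ioo 0 t, s ∈ Ioo 0 T := fun s hs => ⟨hs.1, hs.2.trans ht.2⟩
  have hinv := fracIntegral_fracIntegral_deriv (y := fun s => L (y s)) ha ht.1.le
    (L.continuous.comp_continuousOn (hc.mono (Icc_subset_Icc_right ht.2.le)))
    (fun s hs => (hderiv s (hmem s hs)).differentiableAt) (by
      have hLi : IntervalIntegrable (fun s => L ((t - s) ^ (-a) • deriv y s)) volume 0 t :=
        ⟨L.integrable_comp (hi t ht).1, L.integrable_comp (hi t ht).2⟩
      refine hLi.congr_uIoo fun s hs => ?_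
      rw [uIoo_of_le ht.1.le] at hs
      simp only [map_smul]
      rw [(hderiv s (hmem s hs)).deriv])
  rw [← sub_eq_iff_eq_add', ← hinv]
  refine fracIntegral_congr ht.1.le fun s hs => ?_
  have hs := hmem s hs
  rw [← hL s hs, map_fracIntegral L (by simpa only [sub_sub_cancel_left] using hi s hs)]
  exact fracIntegral_congr hs.1.le fun r hr => (hderiv r ⟨hr.1, hr.2.trans hs.2⟩).deriv

end FractionalIntegral

theorem continuousOn_sub_rpow_neg_mul_sub {a t : ℝ} (ha : a < 1) {y : ℝ → ℝ}
    (hy : ContinuousOn y (Icc 0 t)) (hd : DifferentiableAt ℝ y t) :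
    ContinuousOn (fun s => (t - s) ^ (-a) * (y s - y t)) (Icc 0 t) := by
  have ha' : 0 < 1 - a := sub_pos.2 ha
  have hdslope : ContinuousOn (dslope y t) (Icc 0 t) := by
    intro s hs
    rcases eq_or_ne s t with rfl | hst
    · exact (continuousAt_dslope_same.2 hd).continuousWithinAt
    · exact (continuousWithinAt_dslope_of_ne hst).2 (hy s hs)
  have hpow : Continuous fun s : ℝ => (t - s) ^ (1 - a) :=
    (Real.continuous_rpow_const ha'.le).comp (continuous_const.sub continuous_id)
  refine (hpow.continuousOn.mul hdslope).neg.congr fun s hs => ?_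
  rcases hs.2.eq_or_lt with rfl | hst
  · simp [Real.zero_rpow ha'.ne']
  · rw [← sub_smul_dslope, smul_eq_mul, Pi.neg_apply, Pi.mul_apply,
      show 1 - a = -a + 1 by ring, Real.rpow_add_one (sub_pos.2 hst).ne']
    ring

theorem fracIntegral_deriv_le_of_isMinOn {a t : ℝ} (ha : a ∈ Ioo (0 : ℝ) 1) (ht : 0 < t)
    {y : ℝ → ℝ} (hy : ContinuousOn y (Icc 0 t)) (hd : ∀ s ∈ Ioc 0 t, DifferentiableAt ℝ y s)
    (hint : IntervalIntegrable (fun s => (t - s) ^ (-a) * deriv y s) volume 0 t)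
    (hmin : IsMinOn y (Icc 0 t) t) :
    fracIntegral (1 - a) (deriv y) t ≤ t ^ (-a) / Real.Gamma (1 - a) * (y t - y 0) := by
  have hderiv : ∀ s ∈ Ioo 0 t, HasDerivAt (fun s => (t - s) ^ (-a) * (y s - y t))
      (a * (t - s) ^ (-a - 1) * (y s - y t) + (t - s) ^ (-a) * deriv y s) s := by
    intro s hs
    have hpow := ((hasDerivAt_id s).const_sub t).rpow_const (p := -a)
      (Or.inl (sub_pos.2 hs.2).ne')
    refine (hpow.mul ((hd s ⟨hs.1, hs.2.le⟩).hasDerivAt.sub_const (y t))).congr_deriv ?_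
    simp only [id_eq]
    ring
  have hle : ∀ s ∈ Ioo 0 t, (t - s) ^ (-a) * deriv y s ≤
      a * (t - s) ^ (-a - 1) * (y s - y t) + (t - s) ^ (-a) * deriv y s := fun s hs =>
    le_add_of_nonneg_left (mul_nonneg
      (mul_nonneg ha.1.le (Real.rpow_nonneg (sub_nonneg.2 hs.2.le) _))
      (sub_nonneg.2 (hmin ⟨hs.1.le, hs.2.le⟩)))
  have hintegral := intervalIntegral.integral_le_sub_of_hasDeriv_right_of_le ht.le
    (continuousOn_sub_rpow_neg_mul_sub ha.2 hy (hd t ⟨ht, le_rfl⟩))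
    (fun s hs => (hderiv s hs).hasDerivWithinAt)
    ((intervalIntegrable_iff_integrableOn_Icc_of_le ht.le).1 hint) hle
  have hGamma := Real.Gamma_pos_of_pos (sub_pos.2 ha.2)
  simp only [fracIntegral, sub_sub_cancel_left, smul_eq_mul]
  rw [inv_mul_le_iff₀ hGamma]
  refine hintegral.trans_eq ?_
  rw [sub_self (y t), mul_zero, sub_zero]
  field_simp
  ring

/-! ### The Mittag-Leffler function -/

section MittagLeffler

variable {γ t x : ℝ}

theorem exp_neg_mul_rpow_le_Gamma {R : ℝ} (hR : 0 < R) (hx : 0 ≤ x) :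
    Real.exp (-R) * R ^ x ≤ Real.Gamma (x + 1) := by
  have hconv := Real.GammaIntegral_convergent (s := x + 1) (by linarith)
  rw [add_sub_cancel_right] at hconv
  calc Real.exp (-R) * R ^ x
      = ∫ y in Ioi R, Real.exp (-y) * R ^ x := by
        rw [integral_mul_const, integral_exp_neg_Ioi]
    _ ≤ ∫ y in Ioi R, Real.exp (-y) * y ^ x := by
        refine setIntegral_mono_on ((integrableOn_exp_neg_Ioi R).mul_const _)
          (hconv.mono_set (Ioi_subset_Ioi hR.le)) measurableSet_Ioi fun y hy => ?_
        have := (mem_Ioi.1 hy).le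
        gcongr
    _ ≤ ∫ y in Ioi (0 : ℝ), Real.exp (-y) * y ^ x := by
        refine setIntegral_mono_set hconv ?_ (Ioi_subset_Ioi hR.le).eventuallyLE
        filter_upwards [ae_restrict_mem measurableSet_Ioi] with y hy
        have := (mem_Ioi.1 hy).le
        simp only [Pi.zero_apply]
        positivity
    _ = Real.Gamma (x + 1) := by
        rw [Real.Gamma_eq_integral (by linarith), add_sub_cancel_right]

theorem Gamma_mul_natCast_add_one_pos (hγ : 0 ≤ γ) (k : ℕ) : 0 < Real.Gamma (γ * k + 1) :=
  Real.Gamma_pos_of_pos (by positivity)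

theorem exists_pow_div_Gamma_le (hγ : 0 < γ) {r : ℝ} (hr : 0 < r) :
    ∃ K : ℝ, ∀ k : ℕ, r ^ k / Real.Gamma (γ * k + 1) ≤ K * (1 / 4) ^ k := by
  set R : ℝ := (4 * r) ^ γ⁻¹
  have hR : 0 < R := by positivity
  refine ⟨Real.exp R, fun k => ?_⟩
  have hpow : R ^ (γ * k) = 4 ^ k * r ^ k := by
    rw [Real.rpow_mul_natCast hR.le, Real.rpow_inv_rpow (by positivity) hγ.ne', mul_pow]
  have hGamma := exp_neg_mul_rpow_le_Gamma hR (show 0 ≤ γ * k by positivity)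
  rw [hpow, Real.exp_neg, inv_mul_le_iff₀ (Real.exp_pos R)] at hGamma
  rw [div_le_iff₀ (Gamma_mul_natCast_add_one_pos hγ.le k), one_div, inv_pow, mul_right_comm,
    ← div_eq_mul_inv, le_div_iff₀ (by positivity), mul_comm]
  exact hGamma

theorem summable_mittagLeffler (hγ : 0 < γ) (x : ℝ) :
    Summable fun k : ℕ => x ^ k / Real.Gamma (γ * k + 1) := by
  obtain ⟨K, hK⟩ := exists_pow_div_Gamma_le hγ (r := |x| + 1) (by positivity)
  have hgeom : Summable fun k : ℕ => K * (1 / 4 : ℝ) ^ k :=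
    (summable_geometric_of_lt_one (by norm_num) (by norm_num)).mul_left K
  refine hgeom.of_norm_bounded fun k => le_trans ?_ (hK k)
  have := Gamma_mul_natCast_add_one_pos hγ.le k
  rw [norm_div, norm_pow, Real.norm_eq_abs, Real.norm_of_nonneg this.le]
  gcongr
  exact le_add_of_nonneg_right zero_le_one

theorem exists_summable_bound_mittagLefflerDeriv (hγ : 0 < γ) {r : ℝ} (hr : 1 ≤ r) :
    ∃ v : ℕ → ℝ, Summable v ∧ ∀ (k : ℕ), ∀ y ∈ Metric.ball (0 : ℝ) r,
      ‖k * y ^ (k - 1) / Real.Gamma (γ * k + 1)‖ ≤ v k := by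
  obtain ⟨K, hK⟩ := exists_pow_div_Gamma_le hγ (zero_lt_one.trans_le hr)
  refine ⟨fun k => K * (1 / 2 : ℝ) ^ k,
    (summable_geometric_of_lt_one (by norm_num) (by norm_num)).mul_left K, fun k y hy => ?_⟩
  have hGamma := Gamma_mul_natCast_add_one_pos hγ.le k
  have hy : |y| ≤ r := (mem_ball_zero_iff.1 hy).le
  have hk : (k : ℝ) ≤ 2 ^ k := mod_cast Nat.lt_two_pow_self.le
  have hpow : |y| ^ (k - 1) ≤ r ^ k :=
    (pow_le_pow_left₀ (abs_nonneg y) hy _).trans (pow_le_pow_right₀ hr (Nat.sub_le k 1))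
  rw [norm_div, norm_mul, norm_pow, Real.norm_eq_abs, Real.norm_eq_abs, Nat.abs_cast,
    Real.norm_of_nonneg hGamma.le]
  calc k * |y| ^ (k - 1) / Real.Gamma (γ * k + 1)
      ≤ 2 ^ k * r ^ k / Real.Gamma (γ * k + 1) := by gcongr
    _ = 2 ^ k * (r ^ k / Real.Gamma (γ * k + 1)) := mul_div_assoc _ _ _
    _ ≤ 2 ^ k * (K * (1 / 4) ^ k) := by gcongr; exact hK k
    _ = K * (1 / 2) ^ k := by rw [mul_left_comm, ← mul_pow]; norm_num

/-- The derivative of `mittagLeffler γ`, as the termwise differentiated power series. -/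
noncomputable def mittagLefflerDeriv (γ x : ℝ) : ℝ :=
  ∑' k : ℕ, k * x ^ (k - 1) / Real.Gamma (γ * k + 1)

theorem summable_mittagLefflerDeriv (hγ : 0 < γ) (x : ℝ) :
    Summable fun k : ℕ => k * x ^ (k - 1) / Real.Gamma (γ * k + 1) := by
  obtain ⟨v, hv, hle⟩ := exists_summable_bound_mittagLefflerDeriv hγ (r := |x| + 1)
    (le_add_of_nonneg_left (abs_nonneg x))
  exact hv.of_norm_bounded fun k => hle k x (by simp)

theorem hasDerivAt_mittagLeffler (hγ : 0 < γ) (x : ℝ) :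
    HasDerivAt (mittagLeffler γ) (mittagLefflerDeriv γ x) x := by
  obtain ⟨v, hv, hle⟩ := exists_summable_bound_mittagLefflerDeriv hγ (r := |x| + 1)
    (le_add_of_nonneg_left (abs_nonneg x))
  have hx : x ∈ Metric.ball (0 : ℝ) (|x| + 1) := by simp
  exact hasDerivAt_tsum_of_isPreconnected hv Metric.isOpen_ball
    (convex_ball (0 : ℝ) (|x| + 1)).isPreconnected
    (fun k y _ => (hasDerivAt_pow k y).div_const _) hle hx (summable_mittagLeffler hγ x) hx

theorem continuous_mittagLeffler (hγ : 0 < γ) : Continuous (mittagLeffler γ) :=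
  continuous_iff_continuousAt.2 fun x => (hasDerivAt_mittagLeffler hγ x).continuousAt

theorem continuous_mittagLefflerDeriv (hγ : 0 < γ) : Continuous (mittagLefflerDeriv γ) := by
  refine continuous_iff_continuousAt.2 fun x => ?_
  obtain ⟨v, hv, hle⟩ := exists_summable_bound_mittagLefflerDeriv hγ (r := |x| + 1)
    (le_add_of_nonneg_left (abs_nonneg x))
  exact (continuousOn_tsum (fun k => by fun_prop) hv hle).continuousAt
    (Metric.isOpen_ball.mem_nhds (by simp))

theorem mittagLeffler_zero (γ : ℝ) : mittagLeffler γ 0 = 1 := by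
  rw [mittagLeffler, tsum_eq_single 0 fun k hk => by simp [hk]]
  simp

theorem hasDerivAt_mittagLeffler_neg_rpow (hγ : 0 < γ) (ht : 0 < t) :
    HasDerivAt (fun s : ℝ => mittagLeffler γ (-s ^ γ))
      (mittagLefflerDeriv γ (-t ^ γ) * -(γ * t ^ (γ - 1))) t :=
  (hasDerivAt_mittagLeffler hγ _).comp t (Real.hasDerivAt_rpow_const (Or.inl ht.ne')).neg

theorem continuous_mittagLeffler_neg_rpow (hγ : 0 < γ) :
    Continuous fun s : ℝ => mittagLeffler γ (-s ^ γ) :=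
  (continuous_mittagLeffler hγ).comp (Real.continuous_rpow_const hγ.le).neg

theorem deriv_mittagLeffler_neg_rpow_eq_tsum (hγ : 0 < γ) (ht : 0 < t) :
    deriv (fun s : ℝ => mittagLeffler γ (-s ^ γ)) t =
      ∑' k : ℕ, (-1) ^ (k + 1) * (t ^ (γ * (k + 1) - 1) / Real.Gamma (γ * (k + 1) - 1 + 1)) := by
  rw [(hasDerivAt_mittagLeffler_neg_rpow hγ ht).deriv, mittagLefflerDeriv,
    (summable_mittagLefflerDeriv hγ _).tsum_eq_zero_add, Nat.cast_zero, zero_mul, zero_div,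
    zero_add, ← tsum_mul_right]
  refine tsum_congr fun k => ?_
  have hpos : 0 < γ * ((k : ℝ) + 1) := by positivity
  have hpow : t ^ (γ * ((k : ℝ) + 1) - 1) = (t ^ γ) ^ k * t ^ (γ - 1) := by
    rw [← Real.rpow_mul_natCast ht.le, ← Real.rpow_add ht]
    ring_nf
  have := (Real.Gamma_pos_of_pos hpos).ne'
  rw [Nat.add_sub_cancel, Nat.cast_succ, Real.Gamma_add_one hpos.ne', sub_add_cancel, hpow,
    neg_pow (t ^ γ)]
  field_simp
  ring

theorem fracIntegral_deriv_mittagLeffler_neg_rpow (hγ : γ ∈ Ioo (0 : ℝ) 1) (ht : 0 < t) :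
    fracIntegral (1 - γ) (deriv fun s : ℝ => mittagLeffler γ (-s ^ γ)) t =
      -mittagLeffler γ (-t ^ γ) := by
  have hexp : ∀ k : ℕ, 1 - γ + (γ * (k + 1) - 1) = γ * k := fun k => by ring
  have hterm : ∀ k : ℕ, (-1 : ℝ) ^ (k + 1) *
      (t ^ (1 - γ + (γ * (k + 1) - 1)) / Real.Gamma (1 - γ + (γ * (k + 1) - 1) + 1)) =
      -((-t ^ γ) ^ k / Real.Gamma (γ * k + 1)) := by
    intro k
    rw [hexp, Real.rpow_mul_natCast ht.le, neg_pow (t ^ γ), pow_succ]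
    ring
  have hsum := hasSum_fracIntegral_rpow (a := 1 - γ) (b := fun k : ℕ => γ * (k + 1) - 1)
    (c := fun k => (-1) ^ (k + 1)) (sub_pos.2 hγ.2)
    (fun k => by have := mul_pos hγ.1 k.cast_add_one_pos; linarith) ht (by
      simp only [hexp, abs_pow, abs_neg, abs_one, one_pow, one_mul, Real.rpow_mul_natCast ht.le]
      exact summable_mittagLeffler hγ.1 (t ^ γ))
  simp only [hterm] at hsum
  rw [fracIntegral_congr ht.le fun s hs => deriv_mittagLeffler_neg_rpow_eq_tsum hγ.1 hs.1,
    ← hsum.tsum_eq, tsum_neg, mittagLeffler]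

theorem intervalIntegrable_sub_rpow_mul_deriv_mittagLeffler (hγ : γ ∈ Ioo (0 : ℝ) 1)
    (ht : 0 < t) : IntervalIntegrable (fun s : ℝ => (t - s) ^ (-γ) *
      deriv (fun s : ℝ => mittagLeffler γ (-s ^ γ)) s) volume 0 t := by
  have hcont : Continuous fun s : ℝ => -γ * mittagLefflerDeriv γ (-s ^ γ) :=
    continuous_const.mul ((continuous_mittagLefflerDeriv hγ.1).comp
      (Real.continuous_rpow_const hγ.1.le).neg)
  refine ((intervalIntegrable_sub_rpow_mul_sub_rpow (sub_pos.2 hγ.2) hγ.1 ht).mul_continuousOn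
    hcont.continuousOn).congr fun s hs => ?_
  rw [uIoc_of_le ht.le] at hs
  simp only [sub_zero, sub_sub_cancel_left]
  rw [(hasDerivAt_mittagLeffler_neg_rpow hγ.1 hs.1).deriv]
  ring

end MittagLeffler

-- At a running minimum `t` of `y s = E(-s ^ γ)` the extremum principle turns `∂^γ y = -y` into
-- `-y t ≤ t ^ (-γ) / Γ(1 - γ) * (y t - 1)`, and this is the asserted lower bound at `t`.
theorem inv_le_mittagLeffler_neg_rpow_of_isMinOn {γ t : ℝ} (hγ : γ ∈ Ioo (0 : ℝ) 1) (ht : 0 ≤ t)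
    (hmin : IsMinOn (fun s => mittagLeffler γ (-s ^ γ)) (Icc 0 t) t) :
    (1 + Real.Gamma (1 - γ) * t ^ γ)⁻¹ ≤ mittagLeffler γ (-t ^ γ) := by
  rcases ht.eq_or_lt with rfl | ht
  · simp [Real.zero_rpow hγ.1.ne', mittagLeffler_zero]
  have hle := fracIntegral_deriv_le_of_isMinOn hγ ht
    (continuous_mittagLeffler_neg_rpow hγ.1).continuousOn
    (fun s hs => (hasDerivAt_mittagLeffler_neg_rpow hγ.1 hs.1).differentiableAt)
    (intervalIntegrable_sub_rpow_mul_deriv_mittagLeffler hγ ht) hmin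
  have hGamma := Real.Gamma_pos_of_pos (sub_pos.2 hγ.2)
  rw [fracIntegral_deriv_mittagLeffler_neg_rpow hγ ht, Real.zero_rpow hγ.1.ne', neg_zero,
    mittagLeffler_zero, Real.rpow_neg ht.le, ← one_div, div_div, one_div_mul_eq_div,
    le_div_iff₀ (by positivity)] at hle
  rw [inv_le_iff_one_le_mul₀ (by positivity)]
  linarith

theorem inv_le_mittagLeffler_neg {γ x : ℝ} (hγ : γ ∈ Ioo (0 : ℝ) 1) (hx : 0 ≤ x) :
    (1 + Real.Gamma (1 - γ) * x)⁻¹ ≤ mittagLeffler γ (-x) := by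
  have hroot : 0 ≤ x ^ γ⁻¹ := Real.rpow_nonneg hx _
  obtain ⟨t, ht, hmin⟩ := isCompact_Icc.exists_isMinOn (nonempty_Icc.2 hroot)
    (continuous_mittagLeffler_neg_rpow hγ.1).continuousOn
  have := Real.Gamma_pos_of_pos (sub_pos.2 hγ.2)
  have htx : t ^ γ ≤ x := by
    simpa [Real.rpow_inv_rpow hx hγ.1.ne'] using Real.rpow_le_rpow ht.1 ht.2 hγ.1.le
  calc (1 + Real.Gamma (1 - γ) * x)⁻¹
      ≤ (1 + Real.Gamma (1 - γ) * t ^ γ)⁻¹ := by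
        have := Real.rpow_nonneg ht.1 γ
        gcongr
    _ ≤ mittagLeffler γ (-t ^ γ) := inv_le_mittagLeffler_neg_rpow_of_isMinOn hγ ht.1
        (hmin.on_subset (Icc_subset_Icc_right ht.2))
    _ ≤ mittagLeffler γ (-(x ^ γ⁻¹) ^ γ) := hmin ⟨hroot, le_rfl⟩
    _ = mittagLeffler γ (-x) := by rw [Real.rpow_inv_rpow hx hγ.1.ne']

theorem inv_one_add_sq_le_mul_mittagLeffler {γ t : ℝ} (hγ : γ ∈ Ioo (0 : ℝ) 1) (ht : 0 ≤ t)
    (z : ℝ) : (1 + z ^ 2)⁻¹ ≤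
      (1 + Real.Gamma (1 - γ) * t ^ γ) * mittagLeffler γ (-z ^ 2 * t ^ γ) := by
  have hGamma := Real.Gamma_pos_of_pos (sub_pos.2 hγ.2)
  have htγ := Real.rpow_nonneg ht γ
  have hE := inv_le_mittagLeffler_neg hγ (x := z ^ 2 * t ^ γ) (by positivity)
  rw [← neg_mul] at hE
  refine le_trans ?_ (mul_le_mul_of_nonneg_left hE (by positivity))
  rw [← div_eq_mul_inv, inv_eq_one_div, div_le_div_iff₀ (by positivity) (by positivity)]
  nlinarith [sq_nonneg z, mul_nonneg hGamma.le htγ]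

/-! ### Linear Volterra equations with a bounded operator -/

section Volterra

variable {E : Type*} [NormedAddCommGroup E] [NormedSpace ℝ E] {γ t T : ℝ} {B : E →L[ℝ] E}
  {y : ℝ → E}

/-- The `N`-th partial sum of the Mittag-Leffler series `E_{γ,1}(t ^ γ B) v` of an operator `B`,
that is, the Picard iterates of `y = v + fracIntegral γ (B y)`. -/
noncomputable def mittagLefflerSum (γ : ℝ) (B : E →L[ℝ] E) (v : E) (N : ℕ) (t : ℝ) : E :=
  ∑ k ∈ Finset.range N, (t ^ (γ * k) / Real.Gamma (γ * k + 1)) • (B ^ k) v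

theorem continuous_rpow_mul_natCast_div_Gamma_smul (hγ : 0 ≤ γ) (k : ℕ) (v : E) :
    Continuous fun s : ℝ => (s ^ (γ * k) / Real.Gamma (γ * k + 1)) • v :=
  ((Real.continuous_rpow_const (by positivity)).div_const _).smul continuous_const

theorem continuous_mittagLefflerSum (hγ : 0 ≤ γ) (v : E) (N : ℕ) :
    Continuous (mittagLefflerSum γ B v N) :=
  continuous_finsetSum _ fun k _ => continuous_rpow_mul_natCast_div_Gamma_smul hγ k _

theorem mittagLefflerSum_succ [CompleteSpace E] (hγ : 0 < γ) (ht : 0 < t) (v : E) (N : ℕ) :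
    mittagLefflerSum γ B v (N + 1) t =
      v + fracIntegral γ (fun s => B (mittagLefflerSum γ B v N s)) t := by
  have hterm : ∀ k : ℕ, fracIntegral γ
      (fun s => (s ^ (γ * k) / Real.Gamma (γ * k + 1)) • (B ^ (k + 1)) v) t =
      (t ^ (γ * (k + 1 : ℕ)) / Real.Gamma (γ * (k + 1 : ℕ) + 1)) • (B ^ (k + 1)) v := by
    intro k
    rw [fracIntegral_smul_const, fracIntegral_rpow hγ (neg_one_lt_zero.trans_le (by positivity)) ht,
      Nat.cast_succ, mul_add_one, add_comm γ]
  have hB : ∀ k : ℕ, B ((B ^ k) v) = (B ^ (k + 1)) v := fun k => by rw [pow_succ']; rfl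
  simp only [mittagLefflerSum, map_sum, map_smul, hB]
  rw [fracIntegral_sum _ hγ ht.le fun k =>
    (continuous_rpow_mul_natCast_div_Gamma_smul hγ.le k _).continuousOn, Finset.sum_range_succ',
    add_comm]
  simp only [hterm]
  simp

theorem norm_sub_mittagLefflerSum_le [CompleteSpace E] {U : ℝ} (hγ : 0 < γ)
    (hc : ContinuousOn y (Icc 0 T)) (hU : ∀ t ∈ Icc 0 T, ‖y t‖ ≤ U)
    (hy : ∀ t ∈ Ioo 0 T, y t = y 0 + fracIntegral γ (fun s => B (y s)) t) (N : ℕ) :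
    ∀ t ∈ Ioo 0 T, ‖y t - mittagLefflerSum γ B (y 0) N t‖ ≤
      U * ‖B‖ ^ N * (t ^ (γ * N) / Real.Gamma (γ * N + 1)) := by
  induction N with
  | zero =>
    intro t ht
    simpa [mittagLefflerSum] using hU t ⟨ht.1.le, ht.2.le⟩
  | succ N ih =>
    intro t ht
    have hrem : y t - mittagLefflerSum γ B (y 0) (N + 1) t =
        fracIntegral γ (fun s => B (y s) - B (mittagLefflerSum γ B (y 0) N s)) t := by
      rw [mittagLefflerSum_succ hγ ht.1, hy t ht, add_sub_add_left_eq_sub]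
      exact (fracIntegral_sub hγ ht.1.le
        (B.continuous.comp_continuousOn (hc.mono (Icc_subset_Icc_right ht.2.le)))
        (B.continuous.comp (continuous_mittagLefflerSum hγ.le _ N)).continuousOn).symm
    rw [hrem, Nat.cast_succ, mul_add_one, add_comm _ γ]
    refine norm_fracIntegral_le hγ (neg_one_lt_zero.trans_le (by positivity)) ht.1 fun s hs => ?_
    rw [← map_sub]
    calc ‖B (y s - mittagLefflerSum γ B (y 0) N s)‖
        ≤ ‖B‖ * (U * ‖B‖ ^ N * (s ^ (γ * N) / Real.Gamma (γ * N + 1))) :=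
          B.le_opNorm_of_le (ih s ⟨hs.1, hs.2.trans_lt ht.2⟩)
      _ = U * ‖B‖ ^ (N + 1) * (s ^ (γ * N) / Real.Gamma (γ * N + 1)) := by ring

theorem tendsto_mittagLefflerSum [CompleteSpace E] (hγ : 0 < γ) (hT : 0 < T)
    (hc : ContinuousOn y (Icc 0 T))
    (hy : ∀ t ∈ Ioo 0 T, y t = y 0 + fracIntegral γ (fun s => B (y s)) t) :
    Tendsto (fun N => mittagLefflerSum γ B (y 0) N T) atTop (𝓝 (y T)) := by
  obtain ⟨U, hU⟩ := isCompact_Icc.exists_bound_of_continuousOn hc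
  have hbound : ∀ N, ‖mittagLefflerSum γ B (y 0) N T - y T‖ ≤
      U * ((‖B‖ * T ^ γ) ^ N / Real.Gamma (γ * N + 1)) := by
    intro N
    have hmem : T ∈ closure (Ioo 0 T) := by
      rw [closure_Ioo hT.ne]
      exact right_mem_Icc.2 hT.le
    have hpow : Continuous fun t : ℝ => U * ‖B‖ ^ N * (t ^ (γ * N) / Real.Gamma (γ * N + 1)) :=
      ((Real.continuous_rpow_const (by positivity)).div_const _).const_mul _
    have hle := ContinuousWithinAt.closure_le hmem
      (((hc T (right_mem_Icc.2 hT.le)).mono Ioo_subset_Icc_self).sub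
        (continuous_mittagLefflerSum hγ.le _ N).continuousWithinAt).norm
      hpow.continuousWithinAt (norm_sub_mittagLefflerSum_le hγ hc hU hy N)
    rw [norm_sub_rev]
    refine hle.trans_eq ?_
    rw [Real.rpow_mul_natCast hT.le, mul_pow]
    ring
  rw [tendsto_iff_norm_sub_tendsto_zero]
  refine squeeze_zero (fun _ => norm_nonneg _) hbound ?_
  simpa using ((summable_mittagLeffler hγ (‖B‖ * T ^ γ)).tendsto_atTop_zero).const_mul U

end Volterra

/-! ### Multiplication operators on `L^p` -/

section Multiplication

variable {X F : Type*} [MeasurableSpace X] {μ : Measure X} [NormedAddCommGroup F]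
  {p : ℝ≥0∞} [Fact (1 ≤ p)]

theorem ae_eq_of_tendsto_Lp {f : ℕ → Lp F p μ} {g : Lp F p μ} {h : X → F}
    (hfg : Tendsto f atTop (𝓝 g)) (hfh : ∀ᵐ x ∂μ, Tendsto (fun k => f k x) atTop (𝓝 (h x))) :
    ∀ᵐ x ∂μ, g x = h x := by
  obtain ⟨φ, hφ, hlim⟩ := (tendstoInMeasure_of_tendsto_Lp hfg).exists_seq_tendsto_ae
  filter_upwards [hlim, hfh] with x hg hh
  exact tendsto_nhds_unique hg (hh.comp hφ.tendsto_atTop)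

variable [NormedSpace ℝ F] {b : X → ℝ} {γ T : ℝ}

/-- Multiplication by an essentially bounded real function, as an operator on `L^p`. -/
noncomputable def mulOperator (F : Type*) [NormedAddCommGroup F] [NormedSpace ℝ F] (p : ℝ≥0∞)
    [Fact (1 ≤ p)] (hb : MemLp b ∞ μ) : Lp F p μ →L[ℝ] Lp F p μ :=
  (ContinuousLinearMap.lsmul ℝ ℝ).holderL μ ∞ p p hb.toLp

theorem coeFn_mulOperator (hb : MemLp b ∞ μ) (f : Lp F p μ) :
    ∀ᵐ x ∂μ, mulOperator F p hb f x = b x • f x := by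
  filter_upwards [(ContinuousLinearMap.lsmul ℝ ℝ).coeFn_holder (r := p) hb.toLp f,
    hb.coeFn_toLp] with x hx hbx
  rw [← hbx]
  exact hx

theorem coeFn_mulOperator_pow (hb : MemLp b ∞ μ) (f : Lp F p μ) (k : ℕ) :
    ∀ᵐ x ∂μ, (mulOperator F p hb ^ k) f x = b x ^ k • f x := by
  induction k with
  | zero => simp
  | succ k ih =>
    rw [pow_succ']
    filter_upwards [coeFn_mulOperator hb ((mulOperator F p hb ^ k) f), ih] with x hx hk
    rw [pow_succ', mul_smul, ← hk]
    exact hx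

theorem coeFn_mittagLefflerSum_mulOperator (hT : 0 ≤ T) (hb : MemLp b ∞ μ) (f : Lp F p μ)
    (N : ℕ) : ∀ᵐ x ∂μ, mittagLefflerSum γ (mulOperator F p hb) f N T x =
      (∑ k ∈ Finset.range N, (T ^ γ * b x) ^ k / Real.Gamma (γ * k + 1)) • f x := by
  have hterm : ∀ᵐ x ∂μ, ∀ k : ℕ, ((T ^ (γ * k) / Real.Gamma (γ * k + 1)) •
      (mulOperator F p hb ^ k) f) x = ((T ^ γ * b x) ^ k / Real.Gamma (γ * k + 1)) • f x := by
    refine ae_all_iff.2 fun k => ?_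
    filter_upwards [Lp.coeFn_smul (T ^ (γ * k) / Real.Gamma (γ * k + 1))
      ((mulOperator F p hb ^ k) f), coeFn_mulOperator_pow hb f k] with x hx hk
    rw [hx, Pi.smul_apply, hk, smul_smul, Real.rpow_mul_natCast hT, mul_pow, div_mul_eq_mul_div]
  filter_upwards [Lp.coeFn_finsetSum (Finset.range N) fun k : ℕ =>
    (T ^ (γ * k) / Real.Gamma (γ * k + 1)) • (mulOperator F p hb ^ k) f, hterm] with x hx hk
  rw [mittagLefflerSum, hx, Finset.sum_apply, Finset.sum_smul]
  exact Finset.sum_congr rfl fun k _ => hk k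

theorem ae_eq_mittagLeffler_smul [CompleteSpace F] (hγ : 0 < γ) (hT : 0 < T) (hb : MemLp b ∞ μ)
    {y : ℝ → Lp F p μ} (hc : ContinuousOn y (Icc 0 T))
    (hy : ∀ t ∈ Ioo 0 T, y t = y 0 + fracIntegral γ (fun s => mulOperator F p hb (y s)) t) :
    ∀ᵐ x ∂μ, y T x = mittagLeffler γ (T ^ γ * b x) • y 0 x := by
  refine ae_eq_of_tendsto_Lp (tendsto_mittagLefflerSum hγ hT hc hy) ?_
  filter_upwards [ae_all_iff.2 fun N =>
    coeFn_mittagLefflerSum_mulOperator (γ := γ) hT.le hb (y 0) N] with x hx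
  simp only [hx]
  exact (summable_mittagLeffler hγ _).hasSum.tendsto_sum_nat.smul_const _

end Multiplication

/-! ### The fractional heat equation on the Fourier side -/

section FractionalHeat

variable {n : ℕ}

theorem fourier_toTemperedDistribution_of_eq_laplacian {f w : L2 n}
    (h : (w : 𝓢'(Rn n, ℂ)) = Δ (f : 𝓢'(Rn n, ℂ))) :
    ((𝓕 w : L2 n) : 𝓢'(Rn n, ℂ)) = (-(2 * Real.pi) ^ 2 : ℝ) •
      TemperedDistribution.smulLeftCLM ℂ (fun x : Rn n => Complex.ofReal (‖x‖ ^ 2))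
        ((𝓕 f : L2 n) : 𝓢'(Rn n, ℂ)) := by
  rw [← Lp.fourier_toTemperedDistribution_eq, ← Lp.fourier_toTemperedDistribution_eq, h,
    TemperedDistribution.laplacian_eq_fourierMultiplierCLM,
    TemperedDistribution.fourierMultiplierCLM_apply, ← Complex.coe_smul,
    FourierTransform.fourier_smul, FourierTransform.fourier_fourierInv_eq, Complex.coe_smul]

theorem ae_fourier_eq_of_eq_laplacian {f w : L2 n}
    (h : (w : 𝓢'(Rn n, ℂ)) = Δ (f : 𝓢'(Rn n, ℂ))) :
    ∀ᵐ η : Rn n, (𝓕 w : L2 n) η = -((2 * Real.pi) ^ 2 * ‖η‖ ^ 2) • (𝓕 f : L2 n) η := by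
  have hloc : ∀ g : L2 n, LocallyIntegrable (g : Rn n → ℂ) volume := fun g =>
    (Lp.memLp g).locallyIntegrable (by norm_num)
  have hsymbol : LocallyIntegrable
      (fun η : Rn n => -((2 * Real.pi) ^ 2 * ‖η‖ ^ 2) • (𝓕 f : L2 n) η) volume := by
    rw [← locallyIntegrableOn_univ]
    exact ((hloc (𝓕 f)).locallyIntegrableOn univ).continuousOn_smul isOpen_univ.isLocallyClosed
      (g := fun η : Rn n => -((2 * Real.pi) ^ 2 * ‖η‖ ^ 2)) (by fun_prop)
  refine ae_eq_of_integral_contDiff_smul_eq (hloc _) hsymbol fun g hg hgc => ?_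
  have hgc' : HasCompactSupport (Complex.ofRealCLM ∘ g) := hgc.comp_left rfl
  have hg' : ContDiff ℝ (⊤ : ℕ∞) (Complex.ofRealCLM ∘ g) := by fun_prop
  have htest := congrArg (fun F : 𝓢'(Rn n, ℂ) => F (hgc'.toSchwartzMap hg'))
    (fourier_toTemperedDistribution_of_eq_laplacian h)
  have hgrowth : (fun x : Rn n => ((‖x‖ : ℂ)) ^ 2).HasTemperateGrowth := by
    have : (fun x : Rn n => ((‖x‖ ^ 2 : ℝ) : ℂ)).HasTemperateGrowth := by fun_prop
    simpa using this
  simp only [Lp.toTemperedDistribution_apply, HasCompactSupport.toSchwartzMap_toFun,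
    Function.comp_apply, Complex.ofRealCLM_apply, smul_eq_mul, Complex.ofReal_pow, smul_apply,
    TemperedDistribution.smulLeftCLM_apply_apply,
    SchwartzMap.smulLeftCLM_apply_apply hgrowth] at htest
  simp only [Complex.real_smul]
  rw [htest, Complex.real_smul, ← integral_const_mul]
  refine integral_congr_ae (Eventually.of_forall fun x => ?_)
  push_cast
  ring

theorem memLp_top_indicator_ball {f : Rn n → ℝ} (hf : Continuous f) (R : ℝ) :
    MemLp (indicator (Metric.ball 0 R) f) ∞ volume := by
  obtain ⟨C, hC⟩ := (isCompact_closedBall (0 : Rn n) R).exists_bound_of_continuousOn hf.continuousOn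
  rw [memLp_indicator_iff_restrict Metric.isOpen_ball.measurableSet]
  refine memLp_top_of_bound hf.aestronglyMeasurable C ?_
  filter_upwards [ae_restrict_mem Metric.isOpen_ball.measurableSet] with η hη
  exact hC η (Metric.ball_subset_closedBall hη)

-- Truncating the frequencies to a ball makes the Laplacian a bounded multiplication operator, so
-- that the Picard iterates converge; the ball then exhausts the frequency space.
theorem IsSolution.ae_fourier_final_eq_of_mem_ball {γ T : ℝ} (hγ : γ ∈ Ioo (0 : ℝ) 1)
    (hT : 0 < T) {g : L2 n} {u : ℝ → L2 n} (hu : IsSolution γ T g u) (R : ℝ) :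
    ∀ᵐ η : Rn n, η ∈ Metric.ball 0 R → (𝓕 g : L2 n) η =
      mittagLeffler γ (T ^ γ * -((2 * Real.pi) ^ 2 * ‖η‖ ^ 2)) • (𝓕 (u 0) : L2 n) η := by
  have hone := memLp_top_indicator_ball (n := n) (f := fun _ => 1) continuous_const R
  have hsymbol := memLp_top_indicator_ball (n := n)
    (f := fun η => -((2 * Real.pi) ^ 2 * ‖η‖ ^ 2)) (by fun_prop) R
  set L : L2 n →L[ℝ] L2 n := (mulOperator ℂ 2 hone).comp
    ((Lp.fourierTransformₗᵢ (Rn n) ℂ).toContinuousLinearEquiv.toContinuousLinearMap.restrictScalars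
      ℝ)
  have hL : ∀ f : L2 n, ∀ᵐ η, L f η =
      indicator (Metric.ball 0 R) (fun _ => (1 : ℝ)) η • (𝓕 f : L2 n) η := fun f =>
    coeFn_mulOperator hone (𝓕 f)
  have hcaputo : ∀ t ∈ Ioo 0 T, L (fracIntegral (1 - γ) (deriv u) t) =
      mulOperator ℂ 2 hsymbol (L (u t)) := by
    intro t ht
    have hequation := hu.equation t ht
    rw [caputoDeriv, ← sub_sub_cancel_left 1 γ, one_div, ← fracIntegral] at hequation
    refine Lp.ext ?_
    filter_upwards [hL (fracIntegral (1 - γ) (deriv u) t), hL (u t),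
      coeFn_mulOperator hsymbol (L (u t)), ae_fourier_eq_of_eq_laplacian hequation]
      with η hLcaputo hLu hmul hlaplacian
    rw [hLcaputo, hmul, hLu, hlaplacian]
    by_cases hη : η ∈ Metric.ball 0 R <;> simp [hη]
  have hfinal := ae_eq_mittagLeffler_smul hγ.1 hT hsymbol
    (L.continuous.comp_continuousOn hu.continuousOn)
    (map_eq_add_fracIntegral L _ hγ hu.continuousOn hu.differentiableAt hu.integrable hcaputo)
  filter_upwards [hfinal, hL (u 0), hL g] with η hη h0 hg hball
  simpa [h0, hg, hball, hu.final] using hη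

theorem IsSolution.ae_fourier_final_eq {γ T : ℝ} (hγ : γ ∈ Ioo (0 : ℝ) 1) (hT : 0 < T)
    {g : L2 n} {u : ℝ → L2 n} (hu : IsSolution γ T g u) :
    ∀ᵐ η : Rn n, (𝓕 g : L2 n) η =
      mittagLeffler γ (T ^ γ * -((2 * Real.pi) ^ 2 * ‖η‖ ^ 2)) • (𝓕 (u 0) : L2 n) η := by
  filter_upwards [ae_all_iff.2 fun R : ℕ => hu.ae_fourier_final_eq_of_mem_ball hγ hT R] with η hη
  obtain ⟨R, hR⟩ := exists_nat_gt ‖η‖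
  exact hη R (mem_ball_zero_iff.2 hR)

end FractionalHeat

/-! ### The unitary Fourier transform and Sobolev norms -/

section FourierHat

variable {n : ℕ}

theorem map_smul_volume {r : ℝ} (hr : 0 < r) :
    Measure.map (fun ξ : Rn n => r • ξ) volume = ENNReal.ofReal ((r ^ n)⁻¹) • volume := by
  rw [Measure.map_addHaar_smul volume hr.ne', finrank_euclideanSpace_fin,
    abs_of_pos (by positivity)]

theorem quasiMeasurePreserving_smul {r : ℝ} (hr : 0 < r) :
    Measure.QuasiMeasurePreserving (fun ξ : Rn n => r • ξ) volume volume :=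
  ⟨measurable_const_smul r, by
    rw [map_smul_volume hr]
    exact Measure.smul_absolutelyContinuous⟩

theorem eLpNorm_comp_smul {F : Type*} [NormedAddCommGroup F] {r : ℝ} (hr : 0 < r) {f : Rn n → F}
    (hf : AEStronglyMeasurable f volume) (p : ℝ≥0∞) :
    eLpNorm (fun ξ => f (r • ξ)) p volume =
      ENNReal.ofReal ((r ^ n)⁻¹) ^ (1 / p).toReal * eLpNorm f p volume := by
  have hmap := eLpNorm_map_measure (p := p) (f := fun ξ : Rn n => r • ξ) (g := f) (by
    rw [map_smul_volume hr]
    exact hf.smul_measure _) (measurable_const_smul r).aemeasurable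
  rw [map_smul_volume hr, eLpNorm_smul_measure_of_ne_zero
    (ENNReal.ofReal_pos.2 (by positivity)).ne', smul_eq_mul] at hmap
  rw [hmap, Function.comp_def]

theorem memLp_comp_smul {F : Type*} [NormedAddCommGroup F] {r : ℝ} (hr : 0 < r) {f : Rn n → F}
    {p : ℝ≥0∞} (hf : MemLp f p volume) : MemLp (fun ξ => f (r • ξ)) p volume := by
  refine MemLp.comp_of_map (f := fun ξ : Rn n => r • ξ) ?_ (measurable_const_smul r).aemeasurable
  rw [map_smul_volume hr]
  exact hf.smul_measure ENNReal.ofReal_ne_top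

theorem memLp_fourierHat (f : L2 n) : MemLp (fourierHat f) 2 volume :=
  (memLp_comp_smul (r := (2 * Real.pi)⁻¹) (by positivity)
    (Lp.memLp (𝓕 f : L2 n))).const_smul (((√(2 * Real.pi)) ^ n)⁻¹ : ℝ)

theorem eLpNorm_fourierHat (f : L2 n) :
    eLpNorm (fourierHat f) 2 volume = ENNReal.ofReal ‖f‖ := by
  have hunfold : fourierHat f = (((√(2 * Real.pi)) ^ n)⁻¹ : ℝ) •
      fun ξ : Rn n => (𝓕 f : L2 n) ((2 * Real.pi)⁻¹ • ξ) := rfl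
  have hc : (√(2 * Real.pi)) ^ n ≠ 0 := by positivity
  have hjacobian : ENNReal.ofReal (((2 * Real.pi)⁻¹ ^ n)⁻¹) ^ (1 / (2 : ℝ≥0∞)).toReal =
      ENNReal.ofReal (√(2 * Real.pi) ^ n) := by
    rw [ENNReal.ofReal_rpow_of_pos (by positivity), ENNReal.toReal_div, ENNReal.toReal_one,
      ENNReal.toReal_ofNat, inv_pow, inv_inv, Real.sqrt_eq_rpow, ← Real.rpow_natCast,
      ← Real.rpow_mul_natCast (by positivity), ← Real.rpow_mul (by positivity), mul_comm (n : ℝ)]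
  rw [hunfold, eLpNorm_const_smul, eLpNorm_comp_smul (by positivity) (Lp.aestronglyMeasurable _),
    hjacobian, ← Lp.enorm_def, ← ofReal_norm (𝓕 f), Lp.norm_fourier_eq, ← mul_assoc,
    Real.enorm_of_nonneg (by positivity), ← ENNReal.ofReal_mul (by positivity),
    inv_mul_cancel₀ hc, ENNReal.ofReal_one, one_mul]

theorem fourierHat_sub (f g : L2 n) :
    ∀ᵐ ξ, fourierHat (f - g) ξ = fourierHat f ξ - fourierHat g ξ := by
  have hsub : (𝓕 (f - g) : L2 n) = 𝓕 f - 𝓕 g := map_sub (Lp.fourierTransformₗᵢ (Rn n) ℂ) f g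
  filter_upwards [(quasiMeasurePreserving_smul (n := n) (r := (2 * Real.pi)⁻¹) (by positivity)).ae
    (Lp.coeFn_sub (𝓕 f : L2 n) (𝓕 g))] with ξ hξ
  rw [fourierHat, hsub, hξ, Pi.sub_apply, smul_sub]
  rfl

theorem eq_of_fourierHat_ae_eq {f g : L2 n} (h : ∀ᵐ ξ, fourierHat f ξ = fourierHat g ξ) :
    f = g := by
  have hzero : eLpNorm (fourierHat (f - g)) 2 volume = 0 := by
    rw [eLpNorm_eq_zero_iff (memLp_fourierHat _).aestronglyMeasurable (by norm_num)]
    filter_upwards [h, fourierHat_sub f g] with ξ hfg hsub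
    rw [hsub, hfg, sub_self, Pi.zero_apply]
  rw [eLpNorm_fourierHat, ENNReal.ofReal_eq_zero] at hzero
  exact sub_eq_zero.1 (norm_le_zero_iff.1 hzero)

theorem exists_fourierHat_ae_eq {V : Rn n → ℂ} (hV : MemLp V 2 volume) :
    ∃ v : L2 n, ∀ᵐ ξ, fourierHat v ξ = V ξ := by
  have hpi : (2 * Real.pi) ≠ 0 := by positivity
  have hc : (√(2 * Real.pi)) ^ n ≠ 0 := by positivity
  have hF : MemLp (fun η : Rn n => ((√(2 * Real.pi)) ^ n : ℝ) • V ((2 * Real.pi) • η)) 2 volume :=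
    (memLp_comp_smul (by positivity) hV).const_smul ((√(2 * Real.pi)) ^ n : ℝ)
  refine ⟨𝓕⁻ (hF.toLp _), ?_⟩
  filter_upwards [(quasiMeasurePreserving_smul (n := n) (r := (2 * Real.pi)⁻¹) (by positivity)).ae
    hF.coeFn_toLp] with ξ hξ
  rw [fourierHat, FourierTransform.fourier_fourierInv_eq, hξ, smul_smul, smul_smul,
    mul_inv_cancel₀ hpi, inv_mul_cancel₀ hc, one_smul, one_smul]

theorem sobolevNorm_zero (l : ℝ) : sobolevNorm l (0 : L2 n) = 0 := by
  have hzero : ∀ᵐ ξ : Rn n, fourierHat (0 : L2 n) ξ = 0 := by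
    filter_upwards [fourierHat_sub (0 : L2 n) 0] with ξ hξ
    rw [← sub_zero (0 : L2 n), hξ, sub_self]
  rw [sobolevNorm, eLpNorm_congr_ae (g := 0), eLpNorm_zero]
  filter_upwards [hzero] with ξ hξ
  rw [hξ, mul_zero, Pi.zero_apply]

theorem sobolevNorm_le_add_of_ae_le {l p A B : ℝ} (hA : 0 ≤ A) (hB : 0 ≤ B) {f f₁ f₂ : L2 n}
    (h : ∀ᵐ ξ : Rn n, (1 + ‖ξ‖ ^ 2) ^ (l / 2) * ‖fourierHat f ξ‖ ≤
      A * ((1 + ‖ξ‖ ^ 2) ^ (p / 2) * ‖fourierHat f₁ ξ‖) + B * ‖fourierHat f₂ ξ‖) :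
    sobolevNorm l f ≤
      ENNReal.ofReal A * sobolevNorm p f₁ + ENNReal.ofReal B * ENNReal.ofReal ‖f₂‖ := by
  set F₁ : Rn n → ℂ := fun ξ => (((1 + ‖ξ‖ ^ 2) ^ (p / 2) : ℝ) : ℂ) * fourierHat f₁ ξ
  have hF₁ : AEStronglyMeasurable F₁ volume :=
    (Measurable.aestronglyMeasurable (by fun_prop)).mul (memLp_fourierHat f₁).aestronglyMeasurable
  have hf₂ := (memLp_fourierHat f₂).aestronglyMeasurable
  calc sobolevNorm l f
      ≤ eLpNorm (fun ξ => A * ‖F₁ ξ‖ + B * ‖fourierHat f₂ ξ‖) 2 volume := by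
        refine eLpNorm_mono_ae_real ?_
        filter_upwards [h] with ξ hξ
        have hweight (r : ℝ) : 0 ≤ (1 + ‖ξ‖ ^ 2) ^ (r / 2) := by positivity
        simpa only [F₁, norm_mul, Complex.norm_real, Real.norm_of_nonneg (hweight _)] using hξ
    _ ≤ eLpNorm (A • fun ξ => ‖F₁ ξ‖) 2 volume +
          eLpNorm (B • fun ξ => ‖fourierHat f₂ ξ‖) 2 volume :=
        eLpNorm_add_le (hF₁.norm.const_smul A) (hf₂.norm.const_smul B) (by norm_num)
    _ = ENNReal.ofReal A * sobolevNorm p f₁ + ENNReal.ofReal B * ENNReal.ofReal ‖f₂‖ := by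
        rw [eLpNorm_const_smul, eLpNorm_const_smul, eLpNorm_norm, eLpNorm_norm,
          eLpNorm_fourierHat, Real.enorm_of_nonneg hA, Real.enorm_of_nonneg hB, sobolevNorm]

theorem IsSolution.ae_fourierHat_final_eq {γ T : ℝ} (hγ : γ ∈ Ioo (0 : ℝ) 1) (hT : 0 < T)
    {g : L2 n} {u : ℝ → L2 n} (hu : IsSolution γ T g u) :
    ∀ᵐ ξ : Rn n, fourierHat g ξ =
      (mittagLeffler γ (-‖ξ‖ ^ 2 * T ^ γ) : ℂ) * fourierHat (u 0) ξ := by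
  filter_upwards [(quasiMeasurePreserving_smul (n := n) (r := (2 * Real.pi)⁻¹) (by positivity)).ae
    (hu.ae_fourier_final_eq hγ hT)] with ξ hξ
  have hscale : T ^ γ * -((2 * Real.pi) ^ 2 * ‖(2 * Real.pi)⁻¹ • ξ‖ ^ 2) = -‖ξ‖ ^ 2 * T ^ γ := by
    rw [norm_smul, Real.norm_of_nonneg (by positivity)]
    field_simp
  rw [fourierHat, hξ, hscale, fourierHat, smul_comm, Complex.real_smul]

end FourierHat

/-! ### Frequency weights -/

section Weights

variable {τ s : ℝ}

theorem rpow_mul_exp_neg_mul_le {k y : ℝ} (hτ : 0 < τ) (hk : 0 < k) (hy : 0 ≤ y) :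
    y ^ k * Real.exp (-τ * y) ≤ (k / τ) ^ k := by
  have hbase : y ≤ k / τ * Real.exp (τ * y / k) := by
    calc y = k / τ * (τ * y / k) := by field_simp
      _ ≤ k / τ * Real.exp (τ * y / k) := by
          gcongr
          linarith [Real.add_one_le_exp (τ * y / k)]
  calc y ^ k * Real.exp (-τ * y)
      ≤ (k / τ * Real.exp (τ * y / k)) ^ k * Real.exp (-τ * y) := by gcongr
    _ = (k / τ) ^ k := by
        rw [Real.mul_rpow (by positivity) (Real.exp_pos _).le, ← Real.exp_mul,
          div_mul_cancel₀ _ hk.ne', mul_assoc, ← Real.exp_add, neg_mul, add_neg_cancel,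
          Real.exp_zero, mul_one]

theorem exp_neg_mul_rpow_le_one {x : ℝ} (hτ : 0 ≤ τ) (hx : 0 ≤ x) :
    Real.exp (-τ * x ^ s) ≤ 1 := by
  rw [neg_mul, Real.exp_le_one_iff, neg_nonpos]
  positivity

theorem one_sub_exp_neg_mul_rpow_le {q x : ℝ} (hτ : 0 ≤ τ) (hq : 0 ≤ q) (hqs : q ≤ s)
    (hx : 0 ≤ x) : 1 - Real.exp (-τ * x ^ s) ≤ (1 + τ) * x ^ q := by
  have hxq : 0 ≤ x ^ q := Real.rpow_nonneg hx _
  rcases le_total x 1 with hx1 | hx1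
  · have hpow : x ^ s ≤ x ^ q := Real.rpow_le_rpow_of_exponent_ge' hx hx1 hq hqs
    nlinarith [Real.add_one_le_exp (-τ * x ^ s)]
  · have hone : 1 ≤ x ^ q := Real.one_le_rpow hx1 hq
    nlinarith [Real.exp_pos (-τ * x ^ s)]

theorem one_add_sq_rpow_le {r x : ℝ} (hr : 0 ≤ r) (hx : 0 ≤ x) :
    (1 + x ^ 2) ^ r ≤ 2 ^ r * (1 + x ^ (2 * r)) := by
  have hsq : (x ^ 2) ^ r = x ^ (2 * r) := by
    rw [← Real.rpow_two, ← Real.rpow_mul hx]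
  have hxr : 0 ≤ x ^ (2 * r) := Real.rpow_nonneg hx _
  rcases le_total x 1 with hx1 | hx1
  · calc (1 + x ^ 2) ^ r ≤ 2 ^ r := Real.rpow_le_rpow (by positivity) (by nlinarith) hr
      _ ≤ 2 ^ r * (1 + x ^ (2 * r)) := le_mul_of_one_le_right (by positivity) (by linarith)
  · calc (1 + x ^ 2) ^ r ≤ (2 * x ^ 2) ^ r := Real.rpow_le_rpow (by positivity) (by nlinarith) hr
      _ = 2 ^ r * x ^ (2 * r) := by rw [Real.mul_rpow zero_le_two (sq_nonneg x), hsq]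
      _ ≤ 2 ^ r * (1 + x ^ (2 * r)) := by gcongr; linarith

theorem one_add_sq_rpow_mul_exp_le {r x : ℝ} (hτ : 0 < τ) (hs : 0 < s) (hr : 0 < r)
    (hx : 0 ≤ x) :
    (1 + x ^ 2) ^ r * Real.exp (-τ * x ^ s) ≤ 2 ^ r * (1 + (2 * r / s / τ) ^ (2 * r / s)) := by
  have hpow : x ^ (2 * r) = (x ^ s) ^ (2 * r / s) := by
    rw [← Real.rpow_mul hx, mul_div_cancel₀ _ hs.ne']
  calc (1 + x ^ 2) ^ r * Real.exp (-τ * x ^ s)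
      ≤ 2 ^ r * (1 + x ^ (2 * r)) * Real.exp (-τ * x ^ s) := by
        gcongr
        exact one_add_sq_rpow_le hr.le hx
    _ = 2 ^ r * (Real.exp (-τ * x ^ s) + (x ^ s) ^ (2 * r / s) * Real.exp (-τ * x ^ s)) := by
        rw [hpow]
        ring
    _ ≤ 2 ^ r * (1 + (2 * r / s / τ) ^ (2 * r / s)) := by
        gcongr
        · exact exp_neg_mul_rpow_le_one hτ.le hx
        · exact rpow_mul_exp_neg_mul_le hτ (by positivity) (by positivity)

theorem weight_mul_one_sub_exp_le {p l α z : ℝ} (hτ : 0 ≤ τ) (hlp : l ≤ p) (hpl : p - l ≤ s)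
    (hα : 0 ≤ α) (hz : 0 ≤ z) :
    (1 + z ^ 2) ^ (l / 2) * (1 - Real.exp (-τ * (α * z) ^ s)) ≤
      (1 + τ) * α ^ (p - l) * (1 + z ^ 2) ^ (p / 2) := by
  have hq : 0 ≤ p - l := sub_nonneg.2 hlp
  have hexp : 1 - Real.exp (-τ * (α * z) ^ s) ≤ (1 + τ) * (α ^ (p - l) * z ^ (p - l)) := by
    rw [← Real.mul_rpow hα hz]
    exact one_sub_exp_neg_mul_rpow_le hτ hq hpl (mul_nonneg hα hz)
  have hz_le : z ^ (p - l) ≤ (1 + z ^ 2) ^ ((p - l) / 2) := by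
    calc z ^ (p - l) = (z ^ 2) ^ ((p - l) / 2) := by
          rw [← Real.rpow_two, ← Real.rpow_mul hz, mul_div_cancel₀ _ two_ne_zero]
      _ ≤ (1 + z ^ 2) ^ ((p - l) / 2) := by
          gcongr
          linarith
  calc (1 + z ^ 2) ^ (l / 2) * (1 - Real.exp (-τ * (α * z) ^ s))
      ≤ (1 + z ^ 2) ^ (l / 2) * ((1 + τ) * (α ^ (p - l) * (1 + z ^ 2) ^ ((p - l) / 2))) := by
        gcongr
        exact hexp.trans (by gcongr)
    _ = (1 + τ) * α ^ (p - l) * ((1 + z ^ 2) ^ (l / 2) * (1 + z ^ 2) ^ ((p - l) / 2)) := by ring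
    _ = (1 + τ) * α ^ (p - l) * (1 + z ^ 2) ^ (p / 2) := by
        rw [← Real.rpow_add (by positivity)]
        ring_nf

theorem exists_weight_mul_exp_le {R A : ℝ} (hτ : 0 < τ) (hs : 0 < s) (hR : 0 < R) (hA : 1 ≤ A) :
    ∃ C : ℝ, 0 < C ∧ ∀ α r z : ℝ, 0 < α → α ≤ A → 0 ≤ r → r ≤ R → 0 ≤ z →
      (1 + z ^ 2) ^ (r / 2) * Real.exp (-τ * (α * z) ^ s) ≤ C * α ^ (-r) := by
  set C := 2 ^ (R / 2) * (1 + (2 * (R / 2) / s / τ) ^ (2 * (R / 2) / s))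
  refine ⟨(A ^ 2) ^ (R / 2) * C, by positivity, fun α r z hα hαA hr hrR hz => ?_⟩
  have hA2 : 1 ≤ A ^ 2 := one_le_pow₀ hA
  have hαr : α ^ r = (α ^ 2) ^ (r / 2) := by
    rw [← Real.rpow_two, ← Real.rpow_mul hα.le, mul_div_cancel₀ _ two_ne_zero]
  have hdilate : α ^ 2 * (1 + z ^ 2) ≤ A ^ 2 * (1 + (α * z) ^ 2) := by
    nlinarith [pow_le_pow_left₀ hα.le hαA 2, sq_nonneg (α * z)]
  have hone : 1 ≤ A ^ 2 * (1 + (α * z) ^ 2) := by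
    nlinarith [sq_nonneg (α * z)]
  rw [Real.rpow_neg hα.le, ← div_eq_mul_inv, le_div_iff₀ (by positivity)]
  calc (1 + z ^ 2) ^ (r / 2) * Real.exp (-τ * (α * z) ^ s) * α ^ r
      = (α ^ 2 * (1 + z ^ 2)) ^ (r / 2) * Real.exp (-τ * (α * z) ^ s) := by
        rw [hαr, Real.mul_rpow (sq_nonneg α) (by positivity)]
        ring
    _ ≤ (A ^ 2 * (1 + (α * z) ^ 2)) ^ (r / 2) * Real.exp (-τ * (α * z) ^ s) := by gcongr
    _ ≤ (A ^ 2 * (1 + (α * z) ^ 2)) ^ (R / 2) * Real.exp (-τ * (α * z) ^ s) := by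
        gcongr
    _ = (A ^ 2) ^ (R / 2) * ((1 + (α * z) ^ 2) ^ (R / 2) * Real.exp (-τ * (α * z) ^ s)) := by
        rw [Real.mul_rpow (by positivity) (by positivity), mul_assoc]
    _ ≤ (A ^ 2) ^ (R / 2) * C := by
        gcongr
        exact one_add_sq_rpow_mul_exp_le hτ hs (by positivity) (by positivity)

end Weights

/-! ### Mollified division by a perturbed symbol -/

section Regularization

variable {n : ℕ} {τ s α p q l h D C : ℝ} {m ψ : Rn n → ℝ} {f g gδ v : L2 n}

/-- The Fourier transform of the regularized initial value, for a solution operator that multiplies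
`f̂` by a general symbol of which `ψ` is an approximation. -/
noncomputable def regularizedHat (τ s α : ℝ) (ψ : Rn n → ℝ) (gδ : L2 n) (ξ : Rn n) : ℂ :=
  (((√(2 * Real.pi)) ^ n * kernelHat τ s (α • ξ) : ℝ) : ℂ) * (fourierHat gδ ξ / (ψ ξ : ℂ))

theorem regularizedHat_eq (hα : 0 ≤ α) (ψ : Rn n → ℝ) (gδ : L2 n) (ξ : Rn n) :
    regularizedHat τ s α ψ gδ ξ =
      (Real.exp (-τ * (α * ‖ξ‖) ^ s) : ℂ) * (fourierHat gδ ξ / (ψ ξ : ℂ)) := by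
  have hc : (√(2 * Real.pi)) ^ n ≠ 0 := by positivity
  rw [regularizedHat, kernelHat, mul_inv_cancel_left₀ hc, norm_smul, Real.norm_of_nonneg hα]

theorem le_two_mul_of_abs_sub_le {e y : ℝ} (he : 0 ≤ e) (hh : h ≤ 1 / 2)
    (hye : |y - e| ≤ h * e) : e ≤ 2 * y := by
  nlinarith [(abs_le.1 hye).1]

theorem pos_of_one_add_sq_rpow_le (hD : 0 ≤ D)
    (hm : ∀ ξ, (1 + ‖ξ‖ ^ 2) ^ (-(q / 2)) ≤ D * m ξ) (ξ : Rn n) : 0 < m ξ :=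
  pos_of_mul_pos_right (lt_of_lt_of_le (by positivity) (hm ξ)) hD

theorem ae_pos_and_inv_le (hD : 0 ≤ D) (hm : ∀ ξ, (1 + ‖ξ‖ ^ 2) ^ (-(q / 2)) ≤ D * m ξ)
    (hh : h ≤ 1 / 2) (hψ : ∀ᵐ ξ, |ψ ξ - m ξ| ≤ h * m ξ) :
    ∀ᵐ ξ, 0 < ψ ξ ∧ (ψ ξ)⁻¹ ≤ 2 * D * (1 + ‖ξ‖ ^ 2) ^ (q / 2) := by
  filter_upwards [hψ] with ξ hξ
  have hm_pos := pos_of_one_add_sq_rpow_le hD hm ξ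
  have hmψ : m ξ ≤ 2 * ψ ξ := le_two_mul_of_abs_sub_le hm_pos.le hh hξ
  have hψ_pos : 0 < ψ ξ := by linarith
  refine ⟨hψ_pos, (inv_le_iff_one_le_mul₀ hψ_pos).2 ?_⟩
  calc 1 = (1 + ‖ξ‖ ^ 2) ^ (q / 2) * (1 + ‖ξ‖ ^ 2) ^ (-(q / 2)) := by
        rw [← Real.rpow_add (by positivity), add_neg_cancel, Real.rpow_zero]
    _ ≤ (1 + ‖ξ‖ ^ 2) ^ (q / 2) * (D * (2 * ψ ξ)) := by
        gcongr
        exact (hm ξ).trans (by gcongr)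
    _ = 2 * D * (1 + ‖ξ‖ ^ 2) ^ (q / 2) * ψ ξ := by ring

theorem norm_sub_mollified_quotient_le {e y ε κ : ℝ} {x d : ℂ} (hy : 0 < y)
    (hye : |y - e| ≤ ε * y) (hκ : κ ∈ Icc (0 : ℝ) 1) :
    ‖x - κ * ((e * x - d) / y)‖ ≤ ((1 - κ) + ε) * ‖x‖ + κ * y⁻¹ * ‖d‖ := by
  have hy_ne : (y : ℂ) ≠ 0 := by exact_mod_cast hy.ne'
  have hsplit : x - κ * ((e * x - d) / y) =
      ((1 - κ : ℝ) : ℂ) * x + ((κ * ((y - e) / y) : ℝ) : ℂ) * x + ((κ * y⁻¹ : ℝ) : ℂ) * d := by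
    push_cast
    field_simp
    ring
  have hrel : |κ * ((y - e) / y)| ≤ ε := by
    rw [abs_mul, abs_of_nonneg hκ.1, abs_div, abs_of_pos hy]
    exact (mul_le_of_le_one_left (by positivity) hκ.2).trans ((div_le_iff₀ hy).2 hye)
  have hnoise : 0 ≤ κ * y⁻¹ := mul_nonneg hκ.1 (inv_pos.2 hy).le
  rw [hsplit]
  refine norm_add₃_le.trans ?_
  simp only [norm_mul _ x, norm_mul _ d, Complex.norm_real, Real.norm_eq_abs,
    abs_of_nonneg (sub_nonneg.2 hκ.2), abs_of_nonneg hnoise, ← add_mul]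
  gcongr

theorem ae_norm_sub_regularizedHat_le (hτ : 0 ≤ τ) (hα : 0 ≤ α) (hD : 0 ≤ D)
    (hm : ∀ ξ, (1 + ‖ξ‖ ^ 2) ^ (-(q / 2)) ≤ D * m ξ) (hh0 : 0 ≤ h) (hh : h ≤ 1 / 2)
    (hψ : ∀ᵐ ξ, |ψ ξ - m ξ| ≤ h * m ξ) (hfg : ∀ᵐ ξ, fourierHat g ξ = m ξ * fourierHat f ξ) :
    ∀ᵐ ξ, ‖fourierHat f ξ - regularizedHat τ s α ψ gδ ξ‖ ≤
      ((1 - Real.exp (-τ * (α * ‖ξ‖) ^ s)) + 2 * h) * ‖fourierHat f ξ‖ +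
        2 * D * ((1 + ‖ξ‖ ^ 2) ^ (q / 2) * Real.exp (-τ * (α * ‖ξ‖) ^ s)) *
          ‖fourierHat (g - gδ) ξ‖ := by
  filter_upwards [hψ, ae_pos_and_inv_le hD hm hh hψ, hfg, fourierHat_sub g gδ]
    with ξ hψm hψ_inv hg hsub
  set κ := Real.exp (-τ * (α * ‖ξ‖) ^ s)
  have hκ_mem : κ ∈ Icc (0 : ℝ) 1 :=
    ⟨(Real.exp_pos _).le, exp_neg_mul_rpow_le_one hτ (by positivity)⟩
  have hrel : |ψ ξ - m ξ| ≤ 2 * h * ψ ξ := hψm.trans (by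
    have := le_two_mul_of_abs_sub_le (pos_of_one_add_sq_rpow_le hD hm ξ).le hh hψm
    nlinarith)
  have hgδ : fourierHat gδ ξ = m ξ * fourierHat f ξ - fourierHat (g - gδ) ξ := by
    rw [hsub, hg, sub_sub_cancel]
  rw [regularizedHat_eq hα, hgδ]
  refine (norm_sub_mollified_quotient_le hψ_inv.1 hrel hκ_mem).trans ?_
  calc ((1 - κ) + 2 * h) * ‖fourierHat f ξ‖ + κ * (ψ ξ)⁻¹ * ‖fourierHat (g - gδ) ξ‖
      ≤ ((1 - κ) + 2 * h) * ‖fourierHat f ξ‖ +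
          κ * (2 * D * (1 + ‖ξ‖ ^ 2) ^ (q / 2)) * ‖fourierHat (g - gδ) ξ‖ := by
        gcongr
        exact hψ_inv.2
    _ = _ := by ring

theorem memLp_regularizedHat (hα : 0 ≤ α) (hD : 0 ≤ D)
    (hm : ∀ ξ, (1 + ‖ξ‖ ^ 2) ^ (-(q / 2)) ≤ D * m ξ) (hh : h ≤ 1 / 2)
    (hψ : ∀ᵐ ξ, |ψ ξ - m ξ| ≤ h * m ξ) (hψ_meas : AEStronglyMeasurable ψ volume)
    (hweight : ∀ z : ℝ, 0 ≤ z → (1 + z ^ 2) ^ (q / 2) * Real.exp (-τ * (α * z) ^ s) ≤ C) :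
    MemLp (regularizedHat τ s α ψ gδ) 2 volume := by
  have hmeas : AEStronglyMeasurable (regularizedHat τ s α ψ gδ) volume := by
    refine AEStronglyMeasurable.mul (Measurable.aestronglyMeasurable ?_)
      ((memLp_fourierHat gδ).aestronglyMeasurable.aemeasurable.div
        hψ_meas.aemeasurable.complex_ofReal).aestronglyMeasurable
    unfold kernelHat
    fun_prop
  refine (memLp_fourierHat gδ).of_le_mul (c := 2 * D * C) hmeas ?_
  filter_upwards [ae_pos_and_inv_le hD hm hh hψ] with ξ hψ_inv
  rw [regularizedHat_eq hα, norm_mul, norm_div, Complex.norm_real, Complex.norm_real,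
    Real.norm_of_nonneg (Real.exp_pos _).le, Real.norm_of_nonneg hψ_inv.1.le]
  calc Real.exp (-τ * (α * ‖ξ‖) ^ s) * (‖fourierHat gδ ξ‖ / ψ ξ)
      = Real.exp (-τ * (α * ‖ξ‖) ^ s) * (ψ ξ)⁻¹ * ‖fourierHat gδ ξ‖ := by ring
    _ ≤ Real.exp (-τ * (α * ‖ξ‖) ^ s) * (2 * D * (1 + ‖ξ‖ ^ 2) ^ (q / 2)) *
          ‖fourierHat gδ ξ‖ := by
        gcongr
        exact hψ_inv.2
    _ = 2 * D * ((1 + ‖ξ‖ ^ 2) ^ (q / 2) * Real.exp (-τ * (α * ‖ξ‖) ^ s)) *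
          ‖fourierHat gδ ξ‖ := by ring
    _ ≤ 2 * D * C * ‖fourierHat gδ ξ‖ := by
        gcongr
        exact hweight _ (norm_nonneg ξ)

theorem sobolevNorm_sub_le (hτ : 0 ≤ τ) (hα : 0 ≤ α) (hD : 0 ≤ D)
    (hm : ∀ ξ, (1 + ‖ξ‖ ^ 2) ^ (-(q / 2)) ≤ D * m ξ) (hh0 : 0 ≤ h) (hh : h ≤ 1 / 2)
    (hψ : ∀ᵐ ξ, |ψ ξ - m ξ| ≤ h * m ξ) (hfg : ∀ᵐ ξ, fourierHat g ξ = m ξ * fourierHat f ξ)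
    (hv : ∀ᵐ ξ, fourierHat v ξ = regularizedHat τ s α ψ gδ ξ) (hlp : l ≤ p) (hpl : p - l ≤ s)
    (hweight : ∀ z : ℝ, 0 ≤ z → (1 + z ^ 2) ^ ((l + q) / 2) * Real.exp (-τ * (α * z) ^ s) ≤ C) :
    sobolevNorm l (f - v) ≤
      ENNReal.ofReal ((1 + τ) * α ^ (p - l) + 2 * h) * sobolevNorm p f +
        ENNReal.ofReal (2 * D * C) * ENNReal.ofReal ‖g - gδ‖ := by
  have hC : 0 ≤ C := le_trans (by positivity) (hweight 0 le_rfl)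
  refine sobolevNorm_le_add_of_ae_le (by positivity) (by positivity) ?_
  filter_upwards [fourierHat_sub f v, hv,
    ae_norm_sub_regularizedHat_le (s := s) (gδ := gδ) hτ hα hD hm hh0 hh hψ hfg]
    with ξ hsub hvξ herror
  rw [hsub, hvξ]
  set κ := Real.exp (-τ * (α * ‖ξ‖) ^ s)
  have hbase : 1 ≤ 1 + ‖ξ‖ ^ 2 := by nlinarith [sq_nonneg ‖ξ‖]
  set W := (1 + ‖ξ‖ ^ 2) ^ (l / 2)
  have hbias : W * ((1 - κ) + 2 * h) ≤
      ((1 + τ) * α ^ (p - l) + 2 * h) * (1 + ‖ξ‖ ^ 2) ^ (p / 2) := by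
    have hW : W ≤ (1 + ‖ξ‖ ^ 2) ^ (p / 2) :=
      Real.rpow_le_rpow_of_exponent_le hbase (by linarith)
    nlinarith [weight_mul_one_sub_exp_le hτ hlp hpl hα (norm_nonneg ξ)]
  have hnoise : W * ((1 + ‖ξ‖ ^ 2) ^ (q / 2) * κ) ≤ C := by
    rw [← mul_assoc, ← Real.rpow_add (by positivity), ← add_div]
    exact hweight _ (norm_nonneg ξ)
  calc W * ‖fourierHat f ξ - regularizedHat τ s α ψ gδ ξ‖
      ≤ W * (((1 - κ) + 2 * h) * ‖fourierHat f ξ‖ +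
          2 * D * ((1 + ‖ξ‖ ^ 2) ^ (q / 2) * κ) * ‖fourierHat (g - gδ) ξ‖) := by gcongr
    _ = W * ((1 - κ) + 2 * h) * ‖fourierHat f ξ‖ +
          2 * D * (W * ((1 + ‖ξ‖ ^ 2) ^ (q / 2) * κ)) * ‖fourierHat (g - gδ) ξ‖ := by ring
    _ ≤ ((1 + τ) * α ^ (p - l) + 2 * h) * (1 + ‖ξ‖ ^ 2) ^ (p / 2) * ‖fourierHat f ξ‖ +
          2 * D * C * ‖fourierHat (g - gδ) ξ‖ := by gcongr
    _ = _ := by ring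

theorem bias_add_noise_le {A B E δ : ℝ} (hα : 0 < α) (hαA : α ≤ A) (hA : 1 ≤ A) (hE : 0 ≤ E)
    (hB : 0 ≤ B) (hlq : 0 ≤ l + q) (hlp : l ≤ p) (hhα : h ≤ α ^ (p + q))
    (hδα : δ ≤ E * α ^ (p + q)) :
    ((1 + τ) * α ^ (p - l) + 2 * h) * E + B * α ^ (-(l + q)) * δ ≤
      ((1 + τ) + 2 * A ^ (p + q) + B) * (α ^ (p - l) * E) := by
  have hh_le : h ≤ A ^ (p + q) * α ^ (p - l) := by
    calc h ≤ α ^ (l + q) * α ^ (p - l) := by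
          rw [← Real.rpow_add hα]
          convert hhα using 2
          ring
      _ ≤ A ^ (p + q) * α ^ (p - l) := by
          gcongr
          exact (Real.rpow_le_rpow hα.le hαA hlq).trans
            (Real.rpow_le_rpow_of_exponent_le hA (by linarith))
  have hδ_le : α ^ (-(l + q)) * δ ≤ α ^ (p - l) * E := by
    calc α ^ (-(l + q)) * δ ≤ α ^ (-(l + q)) * (E * α ^ (p + q)) := by gcongr
      _ = α ^ (-(l + q)) * α ^ (p + q) * E := by ring
      _ = α ^ (p - l) * E := by
          rw [← Real.rpow_add hα]
          ring_nf
  calc ((1 + τ) * α ^ (p - l) + 2 * h) * E + B * α ^ (-(l + q)) * δ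
      = (1 + τ) * (α ^ (p - l) * E) + 2 * h * E + B * (α ^ (-(l + q)) * δ) := by ring
    _ ≤ (1 + τ) * (α ^ (p - l) * E) + 2 * (A ^ (p + q) * α ^ (p - l)) * E +
          B * (α ^ (p - l) * E) := by gcongr
    _ = _ := by ring

theorem rpow_sub_mul_eq_of_rpow_eq {E δ : ℝ} (hE : 0 < E) (hα : 0 ≤ α) (hpq : p + q ≠ 0)
    (hαpq : α ^ (p + q) = h + δ / E) :
    α ^ (p - l) * E = E ^ ((q + l) / (p + q)) * (δ + h * E) ^ ((p - l) / (p + q)) := by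
  have hsum : δ + h * E = E * α ^ (p + q) := by
    rw [hαpq]
    field_simp
    ring
  have hexponent : (q + l) / (p + q) + (p - l) / (p + q) = 1 := by
    field_simp
    ring
  rw [hsum, Real.mul_rpow hE.le (by positivity), ← Real.rpow_mul hα, mul_div_cancel₀ _ hpq,
    ← mul_assoc, ← Real.rpow_add hE, hexponent, Real.rpow_one, mul_comm]

theorem exists_sobolevNorm_sub_regularized_le_rpow_mul {A : ℝ} (n : ℕ) (hτ : 0 < τ) (hs : 0 < s)
    (hp : 0 < p) (hq : 0 ≤ q) (hD : 0 ≤ D) (hA : 1 ≤ A) :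
    ∃ C : ℝ, 0 < C ∧ ∀ {α h E : ℝ} {m ψ : Rn n → ℝ} {f g gδ : L2 n},
      0 < α → α ≤ A → 0 ≤ E → 0 ≤ h → h ≤ 1 / 2 → h ≤ α ^ (p + q) →
      (∀ ξ, (1 + ‖ξ‖ ^ 2) ^ (-(q / 2)) ≤ D * m ξ) → AEStronglyMeasurable ψ volume →
      (∀ᵐ ξ, |ψ ξ - m ξ| ≤ h * m ξ) → (∀ᵐ ξ, fourierHat g ξ = m ξ * fourierHat f ξ) →
      sobolevNorm p f ≤ ENNReal.ofReal E → ‖g - gδ‖ ≤ E * α ^ (p + q) →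
      ∃ v : L2 n, (∀ᵐ ξ, fourierHat v ξ = regularizedHat τ s α ψ gδ ξ) ∧
        ∀ l : ℝ, 0 ≤ l → l ≤ p → p - l ≤ s →
          sobolevNorm l (f - v) ≤ ENNReal.ofReal (C * (α ^ (p - l) * E)) := by
  obtain ⟨K, hK, hweight⟩ := exists_weight_mul_exp_le hτ hs (add_pos_of_pos_of_nonneg hp hq) hA
  refine ⟨(1 + τ) + 2 * A ^ (p + q) + 2 * D * K, by positivity, ?_⟩
  intro α h E m ψ f g gδ hα hαA hE hh0 hh hhα hm hψ_meas hψ hfg hf hg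
  obtain ⟨v, hv⟩ := exists_fourierHat_ae_eq (memLp_regularizedHat (gδ := gδ) hα.le hD hm hh hψ
    hψ_meas fun z hz => hweight α q z hα hαA hq (by linarith) hz)
  refine ⟨v, hv, fun l hl hlp hpl => ?_⟩
  calc sobolevNorm l (f - v)
      ≤ ENNReal.ofReal ((1 + τ) * α ^ (p - l) + 2 * h) * sobolevNorm p f +
          ENNReal.ofReal (2 * D * (K * α ^ (-(l + q)))) * ENNReal.ofReal ‖g - gδ‖ :=
        sobolevNorm_sub_le hτ.le hα.le hD hm hh0 hh hψ hfg hv hlp hpl fun z hz =>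
          hweight α (l + q) z hα hαA (by positivity) (by linarith) hz
    _ ≤ ENNReal.ofReal ((1 + τ) * α ^ (p - l) + 2 * h) * ENNReal.ofReal E +
          ENNReal.ofReal (2 * D * (K * α ^ (-(l + q)))) * ENNReal.ofReal ‖g - gδ‖ := by gcongr
    _ = ENNReal.ofReal (((1 + τ) * α ^ (p - l) + 2 * h) * E +
          2 * D * K * α ^ (-(l + q)) * ‖g - gδ‖) := by
        rw [← ENNReal.ofReal_mul (by positivity), ← ENNReal.ofReal_mul (by positivity),
          ← ENNReal.ofReal_add (by positivity) (by positivity), ← mul_assoc (2 * D) K]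
    _ ≤ _ := ENNReal.ofReal_le_ofReal
        (bias_add_noise_le hα hαA hA hE (by positivity) (by positivity) hlp hhα hg)

theorem ae_fourierHat_eq_regularizedHat_zero (hs : s ≠ 0) (hm : ∀ ξ, m ξ ≠ 0)
    (hψ : ∀ᵐ ξ, ψ ξ = m ξ) (hfg : ∀ᵐ ξ, fourierHat g ξ = m ξ * fourierHat f ξ) :
    ∀ᵐ ξ, fourierHat f ξ = regularizedHat τ s 0 ψ g ξ := by
  filter_upwards [hψ, hfg] with ξ hψξ hgξ
  have hm_ne : (m ξ : ℂ) ≠ 0 := by exact_mod_cast hm ξ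
  rw [regularizedHat_eq le_rfl, hψξ, hgξ, mul_div_cancel_left₀ _ hm_ne, zero_mul,
    Real.zero_rpow hs, mul_zero, Real.exp_zero, Complex.ofReal_one, one_mul]

theorem exists_sobolevNorm_sub_regularized_le {M : ℝ} (n : ℕ) (hτ : 0 < τ) (hs : 0 < s)
    (hp : 0 < p) (hq : 0 ≤ q) (hD : 0 ≤ D) (hM : 0 ≤ M) :
    ∃ C : ℝ, 0 < C ∧ ∀ {E δ h : ℝ} {m ψ : Rn n → ℝ} {f g gδ : L2 n},
      0 < E → 0 ≤ δ → δ ≤ M * E → 0 ≤ h → h ≤ 1 / 2 →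
      (∀ ξ, (1 + ‖ξ‖ ^ 2) ^ (-(q / 2)) ≤ D * m ξ) → AEStronglyMeasurable ψ volume →
      (∀ᵐ ξ, |ψ ξ - m ξ| ≤ h * m ξ) → (∀ᵐ ξ, fourierHat g ξ = m ξ * fourierHat f ξ) →
      sobolevNorm p f ≤ ENNReal.ofReal E → ‖g - gδ‖ ≤ δ →
      ∃ v : L2 n,
        (∀ᵐ ξ, fourierHat v ξ = regularizedHat τ s ((h + δ / E) ^ (1 / (p + q))) ψ gδ ξ) ∧
        ∀ l : ℝ, 0 ≤ l → l ≤ p → p - l ≤ s →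
          sobolevNorm l (f - v) ≤ ENNReal.ofReal
            (C * E ^ ((q + l) / (p + q)) * (δ + h * E) ^ ((p - l) / (p + q))) := by
  have hpq : 0 < p + q := by positivity
  obtain ⟨C, hC, hbound⟩ := exists_sobolevNorm_sub_regularized_le_rpow_mul n hτ hs hp hq hD
    (Real.one_le_rpow (by linarith : 1 ≤ 1 + M) (one_div_pos.2 hpq).le)
  refine ⟨C, hC, ?_⟩
  intro E δ h m ψ f g gδ hE hδ hδM hh0 hh hm hψ_meas hψ hfg hf hg
  have hδE : δ / E ≤ M := (div_le_iff₀ hE).2 hδM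
  have hδE0 : 0 ≤ δ / E := by positivity
  set α := (h + δ / E) ^ (1 / (p + q)) with hα_def
  have hα : 0 ≤ α := by positivity
  have hαpq : α ^ (p + q) = h + δ / E := by
    rw [hα_def, one_div, Real.rpow_inv_rpow (by positivity) hpq.ne']
  rcases hα.eq_or_lt with hα0 | hα0
  · rw [← hα0, Real.zero_rpow hpq.ne'] at hαpq
    obtain rfl : h = 0 := by linarith
    obtain rfl : δ = 0 := (div_eq_zero_iff.1 (by linarith : δ / E = 0)).resolve_right hE.ne'
    obtain rfl : g = gδ := sub_eq_zero.1 (norm_le_zero_iff.1 hg)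
    refine ⟨f, ?_, fun l _ _ _ => by simp [sobolevNorm_zero]⟩
    rw [← hα0]
    refine ae_fourierHat_eq_regularizedHat_zero hs.ne'
      (fun ξ => (pos_of_one_add_sq_rpow_le hD hm ξ).ne') ?_ hfg
    filter_upwards [hψ] with ξ hξ
    rw [zero_mul] at hξ
    exact sub_eq_zero.1 (abs_nonpos_iff.1 hξ)
  · simp only [mul_assoc C, ← rpow_sub_mul_eq_of_rpow_eq hE hα hpq.ne' hαpq]
    refine hbound hα0 (Real.rpow_le_rpow (by positivity) (by linarith) (by positivity)) hE.le hh0 hh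
      (by linarith) hm hψ_meas hψ hfg hf (hg.trans ?_)
    rw [hαpq, mul_add, mul_div_cancel₀ _ hE.ne']
    nlinarith

end Regularization

theorem IsApproxSymbol.ae_abs_sub_le {n : ℕ} {γ T h : ℝ} (hγ : γ ∈ Ioo (0 : ℝ) 1) (hT : 0 < T)
    (hh : 0 ≤ h) {ψ : ℝ → ℝ → ℝ} (hψ : IsApproxSymbol n γ T h ψ) :
    ∀ᵐ ξ : Rn n, |ψ ‖ξ‖ T - mittagLeffler γ (-‖ξ‖ ^ 2 * T ^ γ)| ≤
      h * mittagLeffler γ (-‖ξ‖ ^ 2 * T ^ γ) := by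
  have hess := hψ.error_le T ⟨hT, le_rfl⟩
  rw [eLpNorm_exponent_top] at hess
  filter_upwards [ae_le_eLpNormEssSup (μ := (volume : Measure (Rn n))) (f := fun ξ : Rn n =>
      (ψ ‖ξ‖ T - mittagLeffler γ (-‖ξ‖ ^ 2 * T ^ γ)) / mittagLeffler γ (-‖ξ‖ ^ 2 * T ^ γ))]
    with ξ hξ
  have hpos : 0 < mittagLeffler γ (-‖ξ‖ ^ 2 * T ^ γ) := by
    have hΓ := Real.Gamma_pos_of_pos (sub_pos.2 hγ.2)
    exact pos_of_mul_pos_right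
      (lt_of_lt_of_le (by positivity) (inv_one_add_sq_le_mul_mittagLeffler hγ hT.le ‖ξ‖))
      (by positivity)
  have hquotient := hξ.trans hess
  rw [← ofReal_norm, ENNReal.ofReal_le_ofReal_iff hh, norm_div, Real.norm_eq_abs,
    Real.norm_of_nonneg hpos.le, div_le_iff₀ hpos] at hquotient
  exact hquotient

end FracDiffusion

open FracDiffusion in
theorem mainTheorem2 (n : ℕ) (γ T τ s p M : ℝ) (hγ : γ ∈ Set.Ioo (0 : ℝ) 1) (hT : 0 < T)
    (hτ : 0 < τ) (hs : 0 < s) (hp : 0 < p) (hM : 0 < M) :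
    ∃ C : ℝ, 0 < C ∧
      ∀ (E δ h : ℝ) (ψ : ℝ → ℝ → ℝ) (g gδ : L2 n) (u : ℝ → L2 n),
        0 < E → 0 ≤ δ → δ ≤ M * E → 0 ≤ h → h ≤ 1 / 2 →
        IsSolution γ T g u →
        sobolevNorm p (u 0) ≤ ENNReal.ofReal E →
        ‖g - gδ‖ ≤ δ →
        IsApproxSymbol n γ T h ψ →
        ∃ v : L2 n,
          IsRegularizedInitial τ s T ((h + δ / E) ^ (1 / (p + 2))) ψ gδ v ∧
          (∀ w : L2 n,
            IsRegularizedInitial τ s T ((h + δ / E) ^ (1 / (p + 2))) ψ gδ w → w = v) ∧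
          ∀ l : ℝ, 0 ≤ l → l ≤ p → p - l ≤ s →
            sobolevNorm l (u 0 - v) ≤
              ENNReal.ofReal
                (C * E ^ ((2 + l) / (p + 2)) * (δ + h * E) ^ ((p - l) / (p + 2))) := by
  have hD : 0 ≤ 1 + Real.Gamma (1 - γ) * T ^ γ := by
    have := Real.Gamma_pos_of_pos (sub_pos.2 hγ.2)
    positivity
  obtain ⟨C, hC, hbound⟩ :=
    exists_sobolevNorm_sub_regularized_le n hτ hs hp zero_le_two hD hM.le
  refine ⟨C, hC, fun E δ h ψ g gδ u hE hδ hδM hh0 hh hu hu0 hg hψ => ?_⟩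
  have hsymbol (ξ : Rn n) : (1 + ‖ξ‖ ^ 2) ^ (-((2 : ℝ) / 2)) ≤
      (1 + Real.Gamma (1 - γ) * T ^ γ) * mittagLeffler γ (-‖ξ‖ ^ 2 * T ^ γ) := by
    rw [div_self two_ne_zero, Real.rpow_neg_one]
    exact inv_one_add_sq_le_mul_mittagLeffler hγ hT.le ‖ξ‖
  obtain ⟨v, hv, hrate⟩ := hbound hE hδ hδM hh0 hh hsymbol
    (hψ.aestronglyMeasurable T ⟨hT, le_rfl⟩) (hψ.ae_abs_sub_le hγ hT hh0)
    (hu.ae_fourierHat_final_eq hγ hT) hu0 hg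
  refine ⟨v, hv, fun w hw => eq_of_fourierHat_ae_eq ?_, hrate⟩
  filter_upwards [hv, hw] with ξ hvξ hwξ
  rw [hvξ, hwξ, regularizedHat]
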